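/- Let $\Omega\subset\mathbb R^2$ be a bounded open set (in particular, a bounded Lipschitz domain), let $H^1_0(\Omega)$ be the closure of $C_c^\infty(\Omega)$ in $H^1(\Omega)$, and for $\epsilon\in(0,1]$ put $$\|v\|_{\epsilon,\Omega}=\big(\|v\|_{L^2(\Omega)}^2+\epsilon|v|_{1,\Omega}^2\big)^{1/2},\qquad \|\boldsymbol v\|_{\epsilon,\Omega}=\Big(\sum_{i=1}^3\|v_i\|_{\epsilon,\Omega}^2\Big)^{1/2},\qquad \|\boldsymbol\ell\|_{-\epsilon,\Omega}=\sup_{0\ne\boldsymbol v\in (H_0^1(\Omega))^3}\frac{|\langle\boldsymbol\ell,\boldsymbol v\rangle|}{\|\boldsymbol v\|_{\epsilon,\Omega}} .$$ For $\boldsymbol f\in (L^2(\Omega))^3$, $\boldsymbol u=(p,n,\psi)\in (H^1(\Omega))^3$ and $\boldsymbol v,\boldsymbol\phi\in(H^1_0(\Omega))^3$ let $$\langle \boldsymbol F(\boldsymbol u),\boldsymbol v\rangle=\int_\Omega\big(\nabla p\cdot\nabla v_1+p\nabla\psi\cdot\nabla v_1+\nabla n\cdot\nabla v_2-n\nabla\psi\cdot\nabla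 v_2+\epsilon\nabla\psi\cdot\nabla v_3-pv_3+nv_3-f_1v_1-f_2v_2-f_3v_3\big)\,dx,$$ and let $\boldsymbol{DF}(\boldsymbol u)$ be its Gâteaux derivative, $$\langle \boldsymbol{DF}(\boldsymbol u)\boldsymbol\phi,\boldsymbol v\rangle=\int_\Omega\big(\nabla\phi_1\cdot\nabla v_1+p\nabla\phi_3\cdot\nabla v_1+\phi_1\nabla\psi\cdot\nabla v_1+\nabla\phi_2\cdot\nabla v_2-n\nabla\phi_3\cdot\nabla v_2-\phi_2\nabla\psi\cdot\nabla v_2+\epsilon\nabla\phi_3\cdot\nabla v_3-\phi_1v_3+\phi_2v_3\big)\,dx.$$ There is a constant $C_p>0$ with the Poincaré property $\|v\|_{L^2(\Omega)}\le C_p|v|_{1,\Omega}$ for all $v\in H_0^1(\Omega)$; fix any such $C_p$. For $p,n\in L^\infty(\Omega)$ and $\psi\in W^{1,\infty}(\Omega)$ write $$S_\epsilon(\boldsymbol u)=\|\nabla\psi\|_{L^\infty(\Omega)}+\sqrt2\,C_p\,\epsilon^{-1}\max\{\|p\|_{L^\infty(\Omega)},\|n\|_{L^\infty(\Omega)}\},\qquad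 \|\nabla\psi\|_{L^\infty(\Omega)}=\max_{i=1,2}\|\partial_i\psi\|_{L^\infty(\Omega)} .$$ Constants $C_1,C_2>0$ are called regularity constants for $(\epsilon,\boldsymbol u)$ if $$\epsilon C_1\|\boldsymbol R\|_{-\epsilon,\Omega}\le\|\boldsymbol\phi\|_{\epsilon,\Omega}\le C_2\|\boldsymbol R\|_{-\epsilon,\Omega}$$ for all $\boldsymbol R\in(L^2(\Omega))^3$ and all $\boldsymbol\phi\in(H_0^1(\Omega))^3$ such that $\langle\boldsymbol{DF}(\boldsymbol u)\boldsymbol\phi,\boldsymbol v\rangle=\int_\Omega\boldsymbol R\cdot\boldsymbol v\,dx$ for all $\boldsymbol v\in (H_0^1(\Omega))^3$. **Theorem.** (a) There is a constant $C_1>0$, depending only on $\Omega$ and $C_p$, and for every $\theta<\sqrt2/(1+C_p^2)$ there is a constant $K>0$, depending only on $\Omega$, $C_p$ and $\theta$, such that $C_1$ and $C_2=K/\epsilon$ are regularity constants for $(\epsilon,\boldsymbol u)$ whenever $\epsilon\in(0,1]$ and $\boldsymbol u=(p,n,\psi)\in(H^1(\Omega))^3$ with $p,n\in L^\infty(\Omega)$,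 $\psi\in W^{1,\infty}(\Omega)$ and $S_\epsilon(\boldsymbol u)\le\theta$. (b) Let $\epsilon\in(0,1]$, $\boldsymbol f\in(L^2(\Omega))^3$, and let $\boldsymbol u=(p,n,\psi)\in(H^1(\Omega))^3$ be a weak solution, $\langle\boldsymbol F(\boldsymbol u),\boldsymbol v\rangle=0$ for all $\boldsymbol v\in(H^1_0(\Omega))^3$, with $p,n\in L^\infty(\Omega)$, $\psi\in W^{1,\infty}(\Omega)$ and $$S_\epsilon(\boldsymbol u)<\sqrt2/(1+C_p^2).$$ Let $C_1,C_2$ be any regularity constants for $(\epsilon,\boldsymbol u)$. Then for every $\boldsymbol u_h\in(H^1(\Omega))^3$ (in particular, for every finite element solution) whose error $\boldsymbol e=\boldsymbol u-\boldsymbol u_h=(e_1,e_2,e_3)$ belongs to $(H_0^1(\Omega))^3$ and is small in the sense that $\max_{i=1,2}\|e_i\|_{L^\infty(\Omega)}\le\epsilon/(2\sqrt2\,C_2)$, $$\frac{2\epsilon C_1C_2}{C_1+2C_2}\,\|\boldsymbol F(\boldsymbol u_h)\|_{-\epsilon,\Omega}\le\|\boldsymbol e\|_{\epsilon,\Omega}\le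 2C_2\,\|\boldsymbol F(\boldsymbol u_h)\|_{-\epsilon,\Omega}.$$ -/

import Mathlib

open MeasureTheory
open scoped ENNReal ContDiff

noncomputable section

namespace PNP

/-- The plane with its Euclidean norm. -/
abbrev Plane : Type := EuclideanSpace ℝ (Fin 2)

/-- `L²(Ω)`. -/
abbrev L2 (Ω : Set Plane) : Type := Lp ℝ 2 (volume.restrict Ω)

/-- `L²(Ω; ℝ²)`. -/
abbrev L2Vec (Ω : Set Plane) : Type := Lp Plane 2 (volume.restrict Ω)

/-- Pairs (function, vector field) in `L²(Ω) × L²(Ω; ℝ²)` with the Hilbert norm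
`(‖v‖² + ‖g‖²)^{1/2}`. A Sobolev function `v` is represented by the pair `(v, ∇v)`;
the second entry is determined by the first since weak gradients are unique. -/
abbrev Pairs (Ω : Set Plane) : Type := WithLp 2 (L2 Ω × L2Vec Ω)

/-- `φ ∈ C_c^∞(Ω)`. -/
def IsTestFunction (Ω : Set Plane) (φ : Plane → ℝ) : Prop :=
  ContDiff ℝ ∞ φ ∧ HasCompactSupport φ ∧ tsupport φ ⊆ Ω

/-- `∂φ/∂x_i` for a differentiable `φ`. -/
def pderiv (φ : Plane → ℝ) (i : Fin 2) (x : Plane) : ℝ :=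
  fderiv ℝ φ x (EuclideanSpace.single i (1 : ℝ))

theorem IsTestFunction.memLp {Ω : Set Plane} {φ : Plane → ℝ} (h : IsTestFunction Ω φ) :
    MemLp φ 2 (volume.restrict Ω) :=
  (h.1.continuous.memLp_of_hasCompactSupport h.2.1).restrict Ω

theorem IsTestFunction.memLp_pderiv {Ω : Set Plane} {φ : Plane → ℝ} (h : IsTestFunction Ω φ)
    (i : Fin 2) : MemLp (pderiv φ i) 2 (volume.restrict Ω) := by
  have hc : Continuous (pderiv φ i) :=
    (h.1.continuous_fderiv (by simp)).clm_apply continuous_const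
  have hs : HasCompactSupport (pderiv φ i) := h.2.1.fderiv_apply (𝕜 := ℝ) _
  exact (hc.memLp_of_hasCompactSupport hs).restrict Ω

/-- `g` is the weak gradient of `v` in `Ω`. -/
def IsWeakGradient (Ω : Set Plane) (v : L2 Ω) (g : L2Vec Ω) : Prop :=
  ∀ φ : Plane → ℝ, IsTestFunction Ω φ → ∀ i : Fin 2,
    ∫ x in Ω, v x * pderiv φ i x = - ∫ x in Ω, g x i * φ x

theorem memLp_coord {Ω : Set Plane} (g : L2Vec Ω) (i : Fin 2) :
    MemLp (fun x => g x i) 2 (volume.restrict Ω) :=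
  (EuclideanSpace.proj (𝕜 := ℝ) i).comp_memLp' (Lp.memLp g)

/-- `H¹(Ω)`, each function together with its weak gradient. -/
def H1 (Ω : Set Plane) : Submodule ℝ (Pairs Ω) where
  carrier := {v | IsWeakGradient Ω v.fst v.snd}
  zero_mem' := by
    intro φ _ i
    have h1 : ∫ x in Ω, (0 : L2 Ω) x * pderiv φ i x = 0 := by
      rw [← integral_zero Plane ℝ (μ := volume.restrict Ω)]
      refine integral_congr_ae ?_
      filter_upwards [Lp.coeFn_zero ℝ 2 (volume.restrict Ω)] with x hx
      rw [hx]
      simp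
    have h2 : ∫ x in Ω, (0 : L2Vec Ω) x i * φ x = 0 := by
      rw [← integral_zero Plane ℝ (μ := volume.restrict Ω)]
      refine integral_congr_ae ?_
      filter_upwards [Lp.coeFn_zero Plane 2 (volume.restrict Ω)] with x hx
      rw [hx]
      simp
    change ∫ x in Ω, (0 : L2 Ω) x * pderiv φ i x = - ∫ x in Ω, (0 : L2Vec Ω) x i * φ x
    rw [h1, h2, neg_zero]
  add_mem' := by
    intro v w hv hw φ hφ i
    have h1 : ∫ x in Ω, (v.fst + w.fst : L2 Ω) x * pderiv φ i x
        = (∫ x in Ω, v.fst x * pderiv φ i x) + ∫ x in Ω, w.fst x * pderiv φ i x := by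
      refine Eq.trans (integral_congr_ae ?_)
        (integral_add ((Lp.memLp v.fst).integrable_mul (hφ.memLp_pderiv i))
          ((Lp.memLp w.fst).integrable_mul (hφ.memLp_pderiv i)))
      filter_upwards [Lp.coeFn_add v.fst w.fst] with x hx
      rw [hx]
      simp [add_mul]
    have h2 : ∫ x in Ω, (v.snd + w.snd : L2Vec Ω) x i * φ x
        = (∫ x in Ω, v.snd x i * φ x) + ∫ x in Ω, w.snd x i * φ x := by
      refine Eq.trans (integral_congr_ae ?_)
        (integral_add ((memLp_coord v.snd i).integrable_mul hφ.memLp)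
          ((memLp_coord w.snd i).integrable_mul hφ.memLp))
      filter_upwards [Lp.coeFn_add v.snd w.snd] with x hx
      rw [hx]
      simp [add_mul]
    change ∫ x in Ω, (v.fst + w.fst : L2 Ω) x * pderiv φ i x
      = - ∫ x in Ω, (v.snd + w.snd : L2Vec Ω) x i * φ x
    rw [h1, h2, hv φ hφ i, hw φ hφ i, neg_add]
  smul_mem' := by
    intro c v hv φ hφ i
    have h1 : ∫ x in Ω, (c • v.fst : L2 Ω) x * pderiv φ i x
        = c * ∫ x in Ω, v.fst x * pderiv φ i x := by
      rw [← integral_const_mul]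
      refine integral_congr_ae ?_
      filter_upwards [Lp.coeFn_smul c v.fst] with x hx
      simp [hx, mul_assoc]
    have h2 : ∫ x in Ω, (c • v.snd : L2Vec Ω) x i * φ x
        = c * ∫ x in Ω, v.snd x i * φ x := by
      rw [← integral_const_mul]
      refine integral_congr_ae ?_
      filter_upwards [Lp.coeFn_smul c v.snd] with x hx
      simp [hx, mul_assoc]
    change ∫ x in Ω, (c • v.fst : L2 Ω) x * pderiv φ i x
      = - ∫ x in Ω, (c • v.snd : L2Vec Ω) x i * φ x
    rw [h1, h2, hv φ hφ i, mul_neg]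

/-- `H¹₀(Ω)`: the closure in the `H¹` norm of the pairs `(φ, ∇φ)`, `φ ∈ C_c^∞(Ω)`. -/
def H10 (Ω : Set Plane) : Submodule ℝ (Pairs Ω) :=
  (Submodule.span ℝ {v : Pairs Ω | ∃ φ : Plane → ℝ, IsTestFunction Ω φ ∧
    v.fst =ᵐ[volume.restrict Ω] φ ∧
    ∀ i : Fin 2, (fun x => v.snd x i) =ᵐ[volume.restrict Ω] pderiv φ i}).topologicalClosure

/-- Triples `u = (p, n, ψ) = (u 0, u 1, u 2)`. -/
abbrev Triples (Ω : Set Plane) : Type := Fin 3 → Pairs Ω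

/-- `‖v‖_{ε,Ω} = (‖v‖²_{L²} + ε |v|²_{1,Ω})^{1/2}`. -/
def epsNorm {Ω : Set Plane} (ε : ℝ) (v : Pairs Ω) : ℝ :=
  Real.sqrt (‖v.fst‖ ^ 2 + ε * ‖v.snd‖ ^ 2)

/-- `‖u‖_{ε,Ω} = (‖p‖²_{ε,Ω} + ‖n‖²_{ε,Ω} + ‖ψ‖²_{ε,Ω})^{1/2}`. -/
def epsNorm3 {Ω : Set Plane} (ε : ℝ) (u : Triples Ω) : ℝ :=
  Real.sqrt (∑ i, epsNorm ε (u i) ^ 2)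

/-- `‖ℓ‖_{-ε,Ω} = sup { |⟨ℓ, v⟩| / ‖v‖_{ε,Ω} : v ∈ (H¹₀(Ω))³ }`, as an element of `[0, ∞]`;
the term of `v = 0` is `0` for a linear `ℓ`. -/
def dualNorm {Ω : Set Plane} (ε : ℝ) (l : Triples Ω → ℝ) : ℝ≥0∞ :=
  ⨆ v ∈ {v : Triples Ω | ∀ i, v i ∈ H10 Ω}, ENNReal.ofReal (|l v| / epsNorm3 ε v)

/-- `⟨F(u), v⟩`, the weak form of the steady Poisson-Nernst-Planck system with data `f`. -/
def residual {Ω : Set Plane} (ε : ℝ) (f : Fin 3 → L2 Ω) (u v : Triples Ω) : ℝ :=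
  ∫ x in Ω,
    (inner ℝ ((u 0).snd x) ((v 0).snd x) + (u 0).fst x * inner ℝ ((u 2).snd x) ((v 0).snd x)
      + inner ℝ ((u 1).snd x) ((v 1).snd x) - (u 1).fst x * inner ℝ ((u 2).snd x) ((v 1).snd x)
      + ε * inner ℝ ((u 2).snd x) ((v 2).snd x)
      - (u 0).fst x * (v 2).fst x + (u 1).fst x * (v 2).fst x
      - f 0 x * (v 0).fst x - f 1 x * (v 1).fst x - f 2 x * (v 2).fst x)

/-- `⟨DF(u)φ, v⟩`, the Gâteaux derivative of `u ↦ ⟨F(u), v⟩` in the direction `φ`: the coefficient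
of `t` in `⟨F(u + tφ), v⟩`, which is quadratic in `t`. -/
def residualDeriv {Ω : Set Plane} (ε : ℝ) (u φ v : Triples Ω) : ℝ :=
  ∫ x in Ω,
    (inner ℝ ((φ 0).snd x) ((v 0).snd x) + (u 0).fst x * inner ℝ ((φ 2).snd x) ((v 0).snd x)
      + (φ 0).fst x * inner ℝ ((u 2).snd x) ((v 0).snd x)
      + inner ℝ ((φ 1).snd x) ((v 1).snd x) - (u 1).fst x * inner ℝ ((φ 2).snd x) ((v 1).snd x)
      - (φ 1).fst x * inner ℝ ((u 2).snd x) ((v 1).snd x)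
      + ε * inner ℝ ((φ 2).snd x) ((v 2).snd x)
      - (φ 0).fst x * (v 2).fst x + (φ 1).fst x * (v 2).fst x)

/-- `⟨R, v⟩ = ∫_Ω R · v` for `R ∈ (L²(Ω))³`. -/
def loadPairing {Ω : Set Plane} (R : Fin 3 → L2 Ω) (v : Triples Ω) : ℝ :=
  ∫ x in Ω, ∑ i, R i x * (v i).fst x

/-- `u ∈ (H¹(Ω))³` is a weak solution of the system with data `f`. -/
def IsWeakSolution {Ω : Set Plane} (ε : ℝ) (f : Fin 3 → L2 Ω) (u : Triples Ω) : Prop :=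
  (∀ i, u i ∈ H1 Ω) ∧ ∀ v : Triples Ω, (∀ i, v i ∈ H10 Ω) → residual ε f u v = 0

/-- `‖g‖_{L^∞(Ω)}` (used for essentially bounded `g` only). -/
def linfNorm (Ω : Set Plane) (g : Plane → ℝ) : ℝ :=
  (eLpNorm g ∞ (volume.restrict Ω)).toReal

/-- `p, n ∈ L^∞(Ω)` and `ψ ∈ W^{1,∞}(Ω)`. -/
def IsBoundedTriple {Ω : Set Plane} (u : Triples Ω) : Prop :=
  (∀ i, MemLp (u i).fst ∞ (volume.restrict Ω)) ∧ MemLp (u 2).snd ∞ (volume.restrict Ω)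

/-- `‖∇ψ‖_{L^∞} + √2 C_p ε⁻¹ max {‖p‖_{L^∞}, ‖n‖_{L^∞}}`, where `‖∇ψ‖_{L^∞}` is the larger of the
norms of the two partial derivatives. -/
def smallnessQuantity {Ω : Set Plane} (Cp ε : ℝ) (u : Triples Ω) : ℝ :=
  max (linfNorm Ω (fun x => (u 2).snd x 0)) (linfNorm Ω (fun x => (u 2).snd x 1))
    + Real.sqrt 2 * Cp * ε⁻¹ * max (linfNorm Ω (u 0).fst) (linfNorm Ω (u 1).fst)

/-- `C_p` is a Poincaré constant of `Ω`: `‖v‖_{L²} ≤ C_p |v|_{1,Ω}` on `H¹₀(Ω)`. -/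
def IsPoincareConst (Ω : Set Plane) (Cp : ℝ) : Prop :=
  0 < Cp ∧ ∀ v ∈ H10 Ω, ‖v.fst‖ ≤ Cp * ‖v.snd‖

/-- `C₁, C₂ > 0` are constants in the two-sided bound
`ε C₁ ‖R‖_{-ε,Ω} ≤ ‖φ‖_{ε,Ω} ≤ C₂ ‖R‖_{-ε,Ω}` for the solutions `φ ∈ (H¹₀(Ω))³` of the linearized
problem `DF(u)φ = R`, for all `R ∈ (L²(Ω))³`. -/
def AreRegularityConsts {Ω : Set Plane} (ε : ℝ) (u : Triples Ω) (C₁ C₂ : ℝ) : Prop :=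
  0 < C₁ ∧ 0 < C₂ ∧
    ∀ (R : Fin 3 → L2 Ω) (φ : Triples Ω), (∀ i, φ i ∈ H10 Ω) →
      (∀ v : Triples Ω, (∀ i, v i ∈ H10 Ω) → residualDeriv ε u φ v = loadPairing R v) →
      ENNReal.ofReal (ε * C₁) * dualNorm ε (loadPairing R) ≤ ENNReal.ofReal (epsNorm3 ε φ) ∧
      ENNReal.ofReal (epsNorm3 ε φ) ≤ ENNReal.ofReal C₂ * dualNorm ε (loadPairing R)

end PNP

end

noncomputable section

namespace PNP

variable {Ω : Set Plane}

/-! Write `x`, `y`, `z` for the `L²` norms of `∇φ₁`, `∇φ₂`, `∇φ₃`, and let `P` bound `p`, `n` and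
`Γ` bound `|∇ψ|`. Testing the linearized problem with one component of `φ` at a time and using
Poincaré bounds `(1 - Γ Cp) x` and `(1 - Γ Cp) y` by data plus `P z`, and `ε z` by data plus `Cp² (x
+ y)`. Eliminating `z` closes the estimate as soon as `Γ Cp + 2 Cp² P / ε < 1`. With `Γ = √2
‖∇ψ‖_{L^∞}` the left side is `√2 Cp S_ε(u)`, and `2 Cp ≤ 1 + Cp²` turns the assumed threshold into
this condition. This is the upper bound in (a); the lower bound is continuity of the form
(`abs_linForm_le`).

For (b), `F` is quadratic and `F(u) = 0`, so `F(u_h) = -DF(u)e + Q`, where `Q` pairs `e₁∇e₃` and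
`-e₂∇e₃` with `∇v₁` and `∇v₂`. Smallness of `e₁`, `e₂` in `L^∞` gives `‖Q‖_{-ε} ≤ ‖e‖_ε / (2 C₂)`,
which is absorbed.

The difficulty is that arbitrary regularity constants only speak of `L²` right-hand sides, whereas
`DF(u)e` is merely a bounded functional. The triples with `L²` linearized residual are, however,
dense in `(H¹₀)³` (`dense_setOf_exists_loadPairing`): a weight on the third test function makes the
form coercive, Lax–Milgram makes it an isomorphism, and `L²` functionals are dense in the dual
because `H¹₀ → L²` is injective. Both inequalities then pass to the limit
(`AreRegularityConsts.abs_linForm_le_and_epsNorm3_le`). -/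

/-! ### Test functions and weak gradients on `H¹₀(Ω)`. -/

theorem IsTestFunction.add {φ χ : Plane → ℝ} (h : IsTestFunction Ω φ) (k : IsTestFunction Ω χ) :
    IsTestFunction Ω (φ + χ) :=
  ⟨h.1.add k.1, h.2.1.add k.2.1, (tsupport_add φ χ).trans (Set.union_subset h.2.2 k.2.2)⟩

theorem IsTestFunction.const_smul {φ : Plane → ℝ} (h : IsTestFunction Ω φ) (c : ℝ) :
    IsTestFunction Ω (c • φ) :=
  ⟨h.1.const_smul c, h.2.1.smul_left (f := fun _ => c),
    (tsupport_smul_subset_right (fun _ => c) φ).trans h.2.2⟩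

theorem IsTestFunction.differentiable {φ : Plane → ℝ} (h : IsTestFunction Ω φ) :
    Differentiable ℝ φ :=
  h.1.differentiable (by simp)

theorem IsTestFunction.continuous_pderiv {φ : Plane → ℝ} (h : IsTestFunction Ω φ) (i : Fin 2) :
    Continuous (pderiv φ i) :=
  (h.1.continuous_fderiv (by simp)).clm_apply continuous_const

theorem IsTestFunction.hasCompactSupport_pderiv {φ : Plane → ℝ} (h : IsTestFunction Ω φ)
    (i : Fin 2) : HasCompactSupport (pderiv φ i) :=
  h.2.1.fderiv_apply (𝕜 := ℝ) _

theorem IsTestFunction.eq_zero_of_notMem {φ : Plane → ℝ} (h : IsTestFunction Ω φ) {x : Plane}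
    (hx : x ∉ Ω) : φ x = 0 :=
  image_eq_zero_of_notMem_tsupport fun hx' => hx (h.2.2 hx')

/-- A pair `(φ, ∇φ)` with `φ ∈ C_c^∞(Ω)`. -/
def IsTestPair (Ω : Set Plane) (v : Pairs Ω) : Prop :=
  ∃ φ : Plane → ℝ, IsTestFunction Ω φ ∧ v.fst =ᵐ[volume.restrict Ω] φ ∧
    ∀ i : Fin 2, (fun x => v.snd x i) =ᵐ[volume.restrict Ω] pderiv φ i

theorem IsTestPair.zero : IsTestPair Ω 0 := by
  refine ⟨0, ⟨contDiff_const, HasCompactSupport.zero, by simp [tsupport]⟩,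
    Lp.coeFn_zero ℝ 2 _, fun i => ?_⟩
  filter_upwards [Lp.coeFn_zero Plane 2 (volume.restrict Ω)] with x hx
  change (0 : L2Vec Ω) x i = _
  rw [hx]
  simp [pderiv]

theorem IsTestPair.add {v w : Pairs Ω} (hv : IsTestPair Ω v) (hw : IsTestPair Ω w) :
    IsTestPair Ω (v + w) := by
  obtain ⟨φ, hφ, h1, h2⟩ := hv
  obtain ⟨χ, hχ, k1, k2⟩ := hw
  refine ⟨φ + χ, hφ.add hχ, (Lp.coeFn_add v.fst w.fst).trans (h1.add k1), fun i => ?_⟩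
  filter_upwards [Lp.coeFn_add v.snd w.snd, h2 i, k2 i] with x hx a b
  change (v.snd + w.snd : L2Vec Ω) x i = _
  rw [hx, pderiv, fderiv_add (hφ.differentiable x) (hχ.differentiable x)]
  simp only [pderiv] at a b
  simp [a, b]

theorem IsTestPair.smul {v : Pairs Ω} (hv : IsTestPair Ω v) (c : ℝ) : IsTestPair Ω (c • v) := by
  obtain ⟨φ, hφ, h1, h2⟩ := hv
  refine ⟨c • φ, hφ.const_smul c, (Lp.coeFn_smul c v.fst).trans (h1.const_smul c), fun i => ?_⟩
  filter_upwards [Lp.coeFn_smul c v.snd, h2 i] with x hx a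
  change (c • v.snd : L2Vec Ω) x i = _
  rw [hx, pderiv, fderiv_const_smul (hφ.differentiable x)]
  simp only [pderiv] at a
  simp [a]

/-- To check a closed property on `H¹₀(Ω)` it suffices to check it on the pairs `(φ, ∇φ)`. -/
theorem H10_induction {S : Set (Pairs Ω)} (hS : IsClosed S) (h : ∀ v, IsTestPair Ω v → v ∈ S)
    {v : Pairs Ω} (hv : v ∈ H10 Ω) : v ∈ S := by
  have h1 : v ∈ closure ((Submodule.span ℝ {v : Pairs Ω | IsTestPair Ω v} : Submodule ℝ _) :
      Set (Pairs Ω)) := hv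
  refine closure_minimal (fun w hw => h w ?_) hS h1
  -- Test pairs already form a subspace, so the span adds nothing to them.
  induction hw using Submodule.span_induction with
  | mem x hx => exact hx
  | zero => exact .zero
  | add x y _ _ hx hy => exact hx.add hy
  | smul c x _ hx => exact hx.smul c

theorem continuous_fst_pairs : Continuous fun v : Pairs Ω => v.fst :=
  (WithLp.fstL 2 ℝ (L2 Ω) (L2Vec Ω)).continuous

theorem continuous_snd_pairs : Continuous fun v : Pairs Ω => v.snd :=
  (WithLp.sndL 2 ℝ (L2 Ω) (L2Vec Ω)).continuous

theorem IsTestFunction.memLp_single {φ : Plane → ℝ} (h : IsTestFunction Ω φ) (i : Fin 2) :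
    MemLp (fun x => φ x • (EuclideanSpace.single i (1 : ℝ) : Plane)) 2 (volume.restrict Ω) :=
  ((h.1.continuous.smul continuous_const).memLp_of_hasCompactSupport
    (h.2.1.smul_right (f' := fun _ => (EuclideanSpace.single i (1 : ℝ) : Plane)))).restrict Ω

theorem integral_mul_eq_inner {f : Plane → ℝ} (hf : MemLp f 2 (volume.restrict Ω)) (v : L2 Ω) :
    ∫ x in Ω, v x * f x = inner ℝ (hf.toLp f) v := by
  rw [L2.inner_def]
  refine integral_congr_ae ?_
  filter_upwards [hf.coeFn_toLp] with x hx
  simp [hx]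

theorem integral_coord_mul_eq_inner {φ : Plane → ℝ} (h : IsTestFunction Ω φ) (i : Fin 2)
    (g : L2Vec Ω) : ∫ x in Ω, g x i * φ x = inner ℝ ((h.memLp_single i).toLp _) g := by
  rw [L2.inner_def]
  refine integral_congr_ae ?_
  filter_upwards [(h.memLp_single i).coeFn_toLp] with x hx
  simp [hx, inner_smul_left, EuclideanSpace.inner_single_left, mul_comm]

theorem IsTestFunction.integral_mul_pderiv {φ : Plane → ℝ} (h : IsTestFunction Ω φ)
    {g : Plane → ℝ} (hg : Differentiable ℝ g) (hc : ∀ i, Continuous (pderiv g i)) (i : Fin 2) :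
    ∫ x, g x * pderiv φ i x = - ∫ x, pderiv g i x * φ x := by
  refine integral_mul_fderiv_eq_neg_fderiv_mul_of_integrable ?_ ?_ ?_
    (fun x _ => hg x) (fun x _ => h.differentiable x)
  · exact ((hc i).mul h.1.continuous).integrable_of_hasCompactSupport h.2.1.mul_left
  · exact (hg.continuous.mul (h.continuous_pderiv i)).integrable_of_hasCompactSupport
      (h.hasCompactSupport_pderiv i).mul_left
  · exact (hg.continuous.mul h.1.continuous).integrable_of_hasCompactSupport h.2.1.mul_left

theorem IsTestPair.isWeakGradient {v : Pairs Ω} (hv : IsTestPair Ω v) :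
    IsWeakGradient Ω v.fst v.snd := by
  obtain ⟨χ, hχ, h1, h2⟩ := hv
  intro φ hφ i
  have e1 : ∫ x in Ω, v.fst x * pderiv φ i x = ∫ x, χ x * pderiv φ i x := by
    rw [← setIntegral_eq_integral_of_forall_compl_eq_zero (s := Ω)
      (f := fun x => χ x * pderiv φ i x) (fun x hx => by simp [hχ.eq_zero_of_notMem hx])]
    refine integral_congr_ae ?_
    filter_upwards [h1] with x hx
    rw [hx]
  have e2 : ∫ x in Ω, v.snd x i * φ x = ∫ x, pderiv χ i x * φ x := by
    rw [← setIntegral_eq_integral_of_forall_compl_eq_zero (s := Ω)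
      (f := fun x => pderiv χ i x * φ x) (fun x hx => by simp [hφ.eq_zero_of_notMem hx])]
    refine integral_congr_ae ?_
    filter_upwards [h2 i] with x hx
    rw [hx]
  rw [e1, e2]
  exact hφ.integral_mul_pderiv hχ.differentiable hχ.continuous_pderiv i

/-- For a fixed test function, both sides of the defining identity are inner products with fixed
`L²` elements, so the identity survives `H¹` limits. -/
theorem isWeakGradient_of_mem_H10 {v : Pairs Ω} (hv : v ∈ H10 Ω) :
    IsWeakGradient Ω v.fst v.snd := by
  refine H10_induction (S := {v | IsWeakGradient Ω v.fst v.snd}) ?_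
    (fun w hw => hw.isWeakGradient) hv
  simp only [IsWeakGradient, Set.ofPred_forall]
  refine isClosed_iInter fun φ => isClosed_iInter fun hφ => isClosed_iInter fun i => ?_
  simp only [integral_mul_eq_inner (hφ.memLp_pderiv i), integral_coord_mul_eq_inner hφ i]
  exact isClosed_eq (continuous_const.inner continuous_fst_pairs)
    (continuous_const.inner continuous_snd_pairs).neg

/-- The weak gradient of an element of `H¹₀(Ω)` is determined by its first component. -/
theorem eq_zero_of_mem_H10_of_fst_eq_zero (hΩ : IsOpen Ω) {v : Pairs Ω} (hv : v ∈ H10 Ω)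
    (h0 : v.fst = 0) : v = 0 := by
  have hw := isWeakGradient_of_mem_H10 hv
  have key : ∀ i : Fin 2, ∀ᵐ x ∂volume.restrict Ω, v.snd x i = 0 := by
    intro i
    rw [ae_restrict_iff' hΩ.measurableSet]
    refine hΩ.ae_eq_zero_of_integral_contDiff_smul_eq_zero ?_ ?_
    · have : LocallyIntegrable (fun x => v.snd x i) (volume.restrict Ω) :=
        (memLp_coord v.snd i).locallyIntegrable (by norm_num)
      exact locallyIntegrableOn_of_locallyIntegrable_restrict this
    · intro φ h1 h2 h3
      have hφ : IsTestFunction Ω φ := ⟨h1, h2, h3⟩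
      have := hw φ hφ i
      rw [integral_mul_eq_inner (hφ.memLp_pderiv i), h0, inner_zero_right, eq_comm,
        neg_eq_zero] at this
      rw [← setIntegral_eq_integral_of_forall_compl_eq_zero (s := Ω)
        (fun x hx => by simp [hφ.eq_zero_of_notMem hx]), ← this]
      simp [mul_comm]
  have hs : v.snd = 0 := by
    refine Lp.ext ?_
    filter_upwards [key 0, key 1, Lp.coeFn_zero Plane 2 (volume.restrict Ω)] with x a b c
    rw [c]
    ext i
    fin_cases i
    · exact a
    · exact b
  exact (WithLp.equiv 2 (L2 Ω × L2Vec Ω)).injective (Prod.ext h0 hs)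

/-! ### `L²` pairings and Poincaré's inequality. -/

theorem norm_sq_eq_integral {E : Type*} [NormedAddCommGroup E] [InnerProductSpace ℝ E]
    (g : Lp E 2 (volume.restrict Ω)) : ‖g‖ ^ 2 = ∫ x in Ω, ‖g x‖ ^ 2 := by
  rw [← real_inner_self_eq_norm_sq, L2.inner_def]
  simp

/-- The pairing of two `L²` functions against a bounded weight. -/
theorem abs_integral_le_of_norm_le {E F : Type*} [NormedAddCommGroup E] [InnerProductSpace ℝ E]
    [NormedAddCommGroup F] [InnerProductSpace ℝ F] (g : Lp E 2 (volume.restrict Ω))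
    (h : Lp F 2 (volume.restrict Ω)) {B : ℝ} (hB : 0 ≤ B) {f : Plane → ℝ}
    (hf : ∀ᵐ x ∂volume.restrict Ω, |f x| ≤ B * (‖g x‖ * ‖h x‖)) :
    |∫ x in Ω, f x| ≤ B * (‖g‖ * ‖h‖) := by
  have hg' := (Lp.memLp g).norm
  have hh' := (Lp.memLp h).norm
  have hi : Integrable (fun x => ‖g x‖ * ‖h x‖) (volume.restrict Ω) := hg'.integrable_mul hh'
  calc |∫ x in Ω, f x| ≤ ∫ x in Ω, B * (‖g x‖ * ‖h x‖) :=
        norm_integral_le_of_norm_le (f := f) (hi.const_mul B) hf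
    _ = B * ∫ x in Ω, ‖h x‖ * ‖g x‖ := by simp_rw [integral_const_mul, mul_comm]
    _ = B * inner ℝ (hg'.toLp _) (hh'.toLp _) := by
        rw [L2.inner_def]
        congr 1
        refine integral_congr_ae ?_
        filter_upwards [hg'.coeFn_toLp, hh'.coeFn_toLp] with x a b
        simp [a, b]
    _ ≤ B * (‖hg'.toLp _‖ * ‖hh'.toLp _‖) := by gcongr; exact real_inner_le_norm _ _
    _ = B * (‖g‖ * ‖h‖) := by
        rw [Lp.norm_toLp, Lp.norm_toLp, eLpNorm_norm, eLpNorm_norm, Lp.norm_def, Lp.norm_def]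

/-- Poincaré's inequality on a bounded open set. -/
theorem exists_isPoincareConst (hb : Bornology.IsBounded Ω) :
    ∃ Cp : ℝ, IsPoincareConst Ω Cp := by
  obtain ⟨r, hr⟩ := hb.exists_norm_le
  -- The bound `r` need not be positive, but a Poincaré constant must be.
  set R : ℝ := |r| + 1
  have hR : 0 < R := by positivity
  refine ⟨2 * R, by positivity, fun v hv => ?_⟩
  refine H10_induction (S := {v | ‖v.fst‖ ≤ 2 * R * ‖v.snd‖})
    (isClosed_le continuous_fst_pairs.norm (continuous_const.mul continuous_snd_pairs.norm)) ?_ hv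
  rintro w ⟨φ, hφ, h1, h2⟩
  have hsub : ∀ x, HasFDerivAt (fun y : Plane => y 0) (EuclideanSpace.proj (𝕜 := ℝ) 0) x :=
    fun x => (EuclideanSpace.proj (𝕜 := ℝ) (0 : Fin 2)).hasFDerivAt
  have hp : ∀ i x, pderiv (fun y : Plane => y 0 * φ y) i x
      = x 0 * pderiv φ i x + φ x * (EuclideanSpace.single i (1 : ℝ) : Plane) 0 := by
    intro i x
    have := (hsub x).mul (hφ.differentiable x).hasFDerivAt
    rw [pderiv, show (fun y : Plane => y 0 * φ y) = (fun y : Plane => y 0) * φ from rfl,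
      this.fderiv]
    simp [pderiv]
  have hd : Differentiable ℝ fun y : Plane => y 0 * φ y :=
    fun x => ((hsub x).mul (hφ.differentiable x).hasFDerivAt).differentiableAt
  have hx0 : Continuous fun y : Plane => y 0 := (EuclideanSpace.proj (𝕜 := ℝ) (0 : Fin 2)).continuous
  -- Integrating `∂₀(x₀ φ) φ` by parts yields `∫ φ² = -2 ∫ x₀ φ ∂₀φ`; Cauchy–Schwarz with `|x₀| ≤ R`
  -- on `Ω` then finishes.
  have ibp := hφ.integral_mul_pderiv hd (fun i => by
    rw [funext (hp i)]
    exact (hx0.mul (hφ.continuous_pderiv i)).add (hφ.1.continuous.mul continuous_const)) 0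
  simp only [hp] at ibp
  have hI1 : Integrable fun x : Plane => x 0 * φ x * pderiv φ 0 x :=
    ((hx0.mul hφ.1.continuous).mul (hφ.continuous_pderiv 0)).integrable_of_hasCompactSupport
      (hφ.hasCompactSupport_pderiv 0).mul_left
  have hI2 : Integrable fun x : Plane => φ x * φ x :=
    (hφ.1.continuous.mul hφ.1.continuous).integrable_of_hasCompactSupport hφ.2.1.mul_left
  have e : ∫ x, φ x * φ x = -2 * ∫ x : Plane, x 0 * φ x * pderiv φ 0 x := by
    have : ∀ x : Plane, (x 0 * pderiv φ 0 x + φ x * (EuclideanSpace.single 0 (1 : ℝ) : Plane) 0) * φ x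
        = x 0 * φ x * pderiv φ 0 x + φ x * φ x := fun x => by simp; ring
    simp only [this] at ibp
    rw [integral_add hI1 hI2] at ibp
    linarith
  have e' : ‖w.fst‖ ^ 2 = ∫ x in Ω, -2 * (x 0 * φ x * pderiv φ 0 x) := by
    rw [integral_const_mul, norm_sq_eq_integral,
      setIntegral_eq_integral_of_forall_compl_eq_zero (s := Ω)
        (f := fun x : Plane => x 0 * φ x * pderiv φ 0 x)
        (fun x hx => by simp [hφ.eq_zero_of_notMem hx]), ← e,
      ← setIntegral_eq_integral_of_forall_compl_eq_zero (s := Ω) (f := fun x => φ x * φ x)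
        (fun x hx => by simp [hφ.eq_zero_of_notMem hx])]
    refine integral_congr_ae ?_
    filter_upwards [h1] with x hx
    simp [hx, sq]
  have b : |∫ x in Ω, -2 * (x 0 * φ x * pderiv φ 0 x)| ≤ 2 * R * (‖w.fst‖ * ‖w.snd‖) := by
    refine abs_integral_le_of_norm_le w.fst w.snd (by positivity) ?_
    filter_upwards [h1, h2 0] with x a c
    -- Measurability of `Ω` is not assumed, so membership in `Ω` is not available almost everywhere;
    -- outside `Ω` the left side vanishes.
    by_cases hx : x ∈ Ω
    · have h3 : |x 0| ≤ R := by
        have h4 : ‖x 0‖ ≤ ‖x‖ := PiLp.norm_apply_le x 0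
        have h5 := hr x hx
        have h6 := le_abs_self r
        rw [Real.norm_eq_abs] at h4
        simp only [R]
        linarith
      have h4 : |pderiv φ 0 x| ≤ ‖w.snd x‖ := by
        rw [← c]
        exact PiLp.norm_apply_le (w.snd x) 0
      rw [abs_mul, abs_mul, abs_mul, a, Real.norm_eq_abs]
      calc |(-2 : ℝ)| * (|x 0| * |φ x| * |pderiv φ 0 x|) ≤ 2 * (R * |φ x| * ‖w.snd x‖) := by
            rw [abs_neg, abs_two]
            gcongr
        _ = _ := by ring
    · rw [hφ.eq_zero_of_notMem hx]
      simp only [mul_zero, zero_mul, abs_zero]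
      positivity
  rw [← e', abs_of_nonneg (by positivity)] at b
  rcases (norm_nonneg w.fst).eq_or_lt with h | h
  · change ‖w.fst‖ ≤ _
    rw [← h]
    positivity
  · change ‖w.fst‖ ≤ _
    refine le_of_mul_le_mul_left ?_ h
    nlinarith

/-! ### The residual and its linearization as `L²` inner products. -/

/-- `L^∞(Ω)`. -/
abbrev LInf (Ω : Set Plane) : Type := Lp ℝ ∞ (volume.restrict Ω)

/-- `L^∞(Ω; ℝ²)`. -/
abbrev LInfVec (Ω : Set Plane) : Type := Lp Plane ∞ (volume.restrict Ω)

/-- The function `f` is integrable over `Ω` with integral `I`. -/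
def HasIntegralOn (Ω : Set Plane) (f : Plane → ℝ) (I : ℝ) : Prop :=
  IntegrableOn f Ω ∧ ∫ x in Ω, f x = I

namespace HasIntegralOn

variable {f g : Plane → ℝ} {I J : ℝ}

theorem add (hf : HasIntegralOn Ω f I) (hg : HasIntegralOn Ω g J) :
    HasIntegralOn Ω (fun x => f x + g x) (I + J) :=
  ⟨hf.1.add hg.1, by rw [integral_add hf.1 hg.1, hf.2, hg.2]⟩

theorem sub (hf : HasIntegralOn Ω f I) (hg : HasIntegralOn Ω g J) :
    HasIntegralOn Ω (fun x => f x - g x) (I - J) :=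
  ⟨hf.1.sub hg.1, by rw [integral_sub hf.1 hg.1, hf.2, hg.2]⟩

theorem const_mul (c : ℝ) (hf : HasIntegralOn Ω f I) :
    HasIntegralOn Ω (fun x => c * f x) (c * I) :=
  ⟨hf.1.const_mul c, by rw [integral_const_mul, hf.2]⟩

theorem congr (hf : HasIntegralOn Ω f I) (h : f =ᵐ[volume.restrict Ω] g) :
    HasIntegralOn Ω g I :=
  ⟨hf.1.congr h, by rw [← integral_congr_ae h, hf.2]⟩

theorem inner {E : Type*} [NormedAddCommGroup E] [InnerProductSpace ℝ E]
    (g h : Lp E 2 (volume.restrict Ω)) :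
    HasIntegralOn Ω (fun x => inner ℝ (g x) (h x)) (inner ℝ g h) :=
  ⟨L2.integrable_inner g h, rfl⟩

theorem mul (g h : L2 Ω) : HasIntegralOn Ω (fun x => g x * h x) (Inner.inner ℝ g h) :=
  (inner g h).congr (.of_forall fun x => by simp [mul_comm])

theorem smul_inner (p : LInf Ω) (g h : L2Vec Ω) :
    HasIntegralOn Ω (fun x => p x * Inner.inner ℝ (g x) (h x))
      (Inner.inner ℝ (p • g : L2Vec Ω) h) := by
  refine (inner (p • g : L2Vec Ω) h).congr ?_
  filter_upwards [Lp.coeFn_lpSMul (r := 2) p g] with x hx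
  rw [hx, Pi.smul_apply', real_inner_smul_left]

theorem mul_inner (w : L2 Ω) (G : LInfVec Ω) (h : L2Vec Ω) :
    HasIntegralOn Ω (fun x => w x * Inner.inner ℝ (G x) (h x))
      (Inner.inner ℝ (w • G : L2Vec Ω) h) := by
  refine (inner (w • G : L2Vec Ω) h).congr ?_
  filter_upwards [Lp.coeFn_lpSMul (r := 2) w G] with x hx
  rw [hx, Pi.smul_apply', real_inner_smul_left]

end HasIntegralOn

/-- The linearized form with coefficients `p, n ∈ L^∞(Ω)` and `G ∈ L^∞(Ω; ℝ²)`. -/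
def linForm (ε : ℝ) (p n : LInf Ω) (G : LInfVec Ω) (φ v : Triples Ω) : ℝ :=
  inner ℝ (φ 0).snd (v 0).snd + inner ℝ (p • (φ 2).snd : L2Vec Ω) (v 0).snd
    + inner ℝ ((φ 0).fst • G : L2Vec Ω) (v 0).snd
    + inner ℝ (φ 1).snd (v 1).snd - inner ℝ (n • (φ 2).snd : L2Vec Ω) (v 1).snd
    - inner ℝ ((φ 1).fst • G : L2Vec Ω) (v 1).snd
    + ε * inner ℝ (φ 2).snd (v 2).snd
    - inner ℝ (φ 0).fst (v 2).fst + inner ℝ (φ 1).fst (v 2).fst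

theorem residualDeriv_eq_linForm (ε : ℝ) {u : Triples Ω} {p n : LInf Ω} {G : LInfVec Ω}
    (hp : p =ᵐ[volume.restrict Ω] (u 0).fst) (hn : n =ᵐ[volume.restrict Ω] (u 1).fst)
    (hG : G =ᵐ[volume.restrict Ω] (u 2).snd) (φ v : Triples Ω) :
    residualDeriv ε u φ v = linForm ε p n G φ v := by
  have h := ((((((((HasIntegralOn.inner (φ 0).snd (v 0).snd).add
    (.smul_inner p (φ 2).snd (v 0).snd)).add (.mul_inner (φ 0).fst G (v 0).snd)).add
    (.inner (φ 1).snd (v 1).snd)).sub (.smul_inner n (φ 2).snd (v 1).snd)).sub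
    (.mul_inner (φ 1).fst G (v 1).snd)).add ((HasIntegralOn.inner (φ 2).snd (v 2).snd).const_mul ε)).sub
    (.mul (φ 0).fst (v 2).fst)).add (.mul (φ 1).fst (v 2).fst)
  refine (h.congr ?_).2
  filter_upwards [hp, hn, hG] with x a b c
  rw [a, b, c]

/-- The residual as a sum of inner products, when the first two components are bounded. -/
theorem residual_eq_inner (ε : ℝ) (f : Fin 3 → L2 Ω) {u : Triples Ω} {p n : LInf Ω}
    (hp : p =ᵐ[volume.restrict Ω] (u 0).fst) (hn : n =ᵐ[volume.restrict Ω] (u 1).fst)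
    (v : Triples Ω) :
    residual ε f u v = inner ℝ (u 0).snd (v 0).snd + inner ℝ (p • (u 2).snd : L2Vec Ω) (v 0).snd
      + inner ℝ (u 1).snd (v 1).snd - inner ℝ (n • (u 2).snd : L2Vec Ω) (v 1).snd
      + ε * inner ℝ (u 2).snd (v 2).snd
      - inner ℝ (u 0).fst (v 2).fst + inner ℝ (u 1).fst (v 2).fst
      - inner ℝ (f 0) (v 0).fst - inner ℝ (f 1) (v 1).fst - inner ℝ (f 2) (v 2).fst := by
  have h := (((((((((HasIntegralOn.inner (u 0).snd (v 0).snd).add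
    (.smul_inner p (u 2).snd (v 0).snd)).add (.inner (u 1).snd (v 1).snd)).sub
    (.smul_inner n (u 2).snd (v 1).snd)).add
    ((HasIntegralOn.inner (u 2).snd (v 2).snd).const_mul ε)).sub
    (.mul (u 0).fst (v 2).fst)).add (.mul (u 1).fst (v 2).fst)).sub
    (.mul (f 0) (v 0).fst)).sub (.mul (f 1) (v 1).fst)).sub (.mul (f 2) (v 2).fst)
  refine (h.congr ?_).2
  filter_upwards [hp, hn] with x a b
  rw [a, b]

theorem loadPairing_eq_inner (R : Fin 3 → L2 Ω) (v : Triples Ω) :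
    loadPairing R v = ∑ i, inner ℝ (R i) (v i).fst := by
  have h := ((HasIntegralOn.mul (R 0) (v 0).fst).add (.mul (R 1) (v 1).fst)).add
    (.mul (R 2) (v 2).fst)
  rw [Fin.sum_univ_three, ← h.2]
  simp [loadPairing, Fin.sum_univ_three]

/-- Expansion of the residual, which is quadratic, around `u`. -/
theorem residual_sub (ε : ℝ) (f : Fin 3 → L2 Ω) {u e : Triples Ω} {p n d₀ d₁ : LInf Ω}
    {G : LInfVec Ω}
    (hp : p =ᵐ[volume.restrict Ω] (u 0).fst) (hn : n =ᵐ[volume.restrict Ω] (u 1).fst)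
    (hG : G =ᵐ[volume.restrict Ω] (u 2).snd)
    (h₀ : d₀ =ᵐ[volume.restrict Ω] (e 0).fst) (h₁ : d₁ =ᵐ[volume.restrict Ω] (e 1).fst)
    (v : Triples Ω) :
    residual ε f (u - e) v = residual ε f u v - linForm ε p n G e v
      + (inner ℝ (d₀ • (e 2).snd : L2Vec Ω) (v 0).snd
        - inner ℝ (d₁ • (e 2).snd : L2Vec Ω) (v 1).snd) := by
  -- Only the first two components of `u - e` need be bounded: its third gradient enters the
  -- residual as an `L²` field.
  have hp' : (p - d₀ : LInf Ω) =ᵐ[volume.restrict Ω] ((u - e) 0).fst := by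
    filter_upwards [hp, h₀, Lp.coeFn_sub p d₀, Lp.coeFn_sub (u 0).fst (e 0).fst] with x a b c d
    rw [c]
    change _ = ((u 0).fst - (e 0).fst : L2 Ω) x
    rw [d, Pi.sub_apply, Pi.sub_apply, a, b]
  have hn' : (n - d₁ : LInf Ω) =ᵐ[volume.restrict Ω] ((u - e) 1).fst := by
    filter_upwards [hn, h₁, Lp.coeFn_sub n d₁, Lp.coeFn_sub (u 1).fst (e 1).fst] with x a b c d
    rw [c]
    change _ = ((u 1).fst - (e 1).fst : L2 Ω) x
    rw [d, Pi.sub_apply, Pi.sub_apply, a, b]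
  -- The product `eᵢ∇ψ` arises as bounded times `L²` in the expansion and as `L²` times bounded in
  -- `linForm`.
  have swap : ∀ {d : LInf Ω} {w : L2 Ω}, d =ᵐ[volume.restrict Ω] w →
      (d • (u 2).snd : L2Vec Ω) = w • G := by
    intro d w h
    refine Lp.ext ?_
    filter_upwards [h, hG, Lp.coeFn_lpSMul (r := 2) d (u 2).snd,
      Lp.coeFn_lpSMul (r := 2) w G] with x a b c d
    rw [c, d, Pi.smul_apply', Pi.smul_apply', a, b]
  rw [residual_eq_inner ε f hp' hn' v, residual_eq_inner ε f hp hn v, linForm, ← swap h₀, ← swap h₁]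
  have hs : ∀ i, ((u - e) i).snd = (u i).snd - (e i).snd := fun i => rfl
  have hf : ∀ i, ((u - e) i).fst = (u i).fst - (e i).fst := fun i => rfl
  simp only [hs, hf]
  simp only [sub_eq_add_neg, Lp.smul_add, Lp.add_smul, Lp.neg_smul,
    Lp.smul_neg, inner_add_left, inner_neg_left]
  ring

section LinFormAlgebra

variable (ε : ℝ) (p n : LInf Ω) (G : LInfVec Ω)

theorem linForm_add_left (φ χ v : Triples Ω) :
    linForm ε p n G (φ + χ) v = linForm ε p n G φ v + linForm ε p n G χ v := by
  have hs : ∀ i, ((φ + χ) i).snd = (φ i).snd + (χ i).snd := fun i => rfl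
  have hf : ∀ i, ((φ + χ) i).fst = (φ i).fst + (χ i).fst := fun i => rfl
  simp only [linForm, hs, hf, Lp.smul_add, Lp.add_smul, inner_add_left]
  ring

theorem linForm_smul_left (c : ℝ) (φ v : Triples Ω) :
    linForm ε p n G (c • φ) v = c * linForm ε p n G φ v := by
  have hs : ∀ i, ((c • φ) i).snd = c • (φ i).snd := fun i => rfl
  have hf : ∀ i, ((c • φ) i).fst = c • (φ i).fst := fun i => rfl
  simp only [linForm, hs, hf, Lp.smul_assoc, ← Lp.smul_comm c, real_inner_smul_left]
  ring

theorem linForm_add_right (φ v w : Triples Ω) :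
    linForm ε p n G φ (v + w) = linForm ε p n G φ v + linForm ε p n G φ w := by
  have hs : ∀ i, ((v + w) i).snd = (v i).snd + (w i).snd := fun i => rfl
  have hf : ∀ i, ((v + w) i).fst = (v i).fst + (w i).fst := fun i => rfl
  simp only [linForm, hs, hf, inner_add_right]
  ring

theorem linForm_smul_right (c : ℝ) (φ v : Triples Ω) :
    linForm ε p n G φ (c • v) = c * linForm ε p n G φ v := by
  have hs : ∀ i, ((c • v) i).snd = c • (v i).snd := fun i => rfl
  have hf : ∀ i, ((c • v) i).fst = c • (v i).fst := fun i => rfl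
  simp only [linForm, hs, hf, real_inner_smul_right]
  ring

end LinFormAlgebra

/-! ### The `ε`-norm and continuity of the linearized form. -/

theorem epsNorm3_nonneg (ε : ℝ) (v : Triples Ω) : 0 ≤ epsNorm3 ε v := Real.sqrt_nonneg _

theorem epsNorm_sq {ε : ℝ} (hε : 0 ≤ ε) (v : Pairs Ω) :
    epsNorm ε v ^ 2 = ‖v.fst‖ ^ 2 + ε * ‖v.snd‖ ^ 2 :=
  Real.sq_sqrt (by positivity)

theorem epsNorm3_sq {ε : ℝ} (hε : 0 ≤ ε) (v : Triples Ω) :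
    epsNorm3 ε v ^ 2 = ∑ i, (‖(v i).fst‖ ^ 2 + ε * ‖(v i).snd‖ ^ 2) := by
  rw [epsNorm3, Real.sq_sqrt (by positivity)]
  simp_rw [epsNorm_sq hε]

theorem norm_sq_le_epsNorm3_sq {ε : ℝ} (hε : 0 ≤ ε) (v : Triples Ω) (i : Fin 3) :
    ‖(v i).fst‖ ^ 2 + ε * ‖(v i).snd‖ ^ 2 ≤ epsNorm3 ε v ^ 2 := by
  rw [epsNorm3_sq hε]
  exact Finset.single_le_sum (f := fun i => ‖(v i).fst‖ ^ 2 + ε * ‖(v i).snd‖ ^ 2)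
    (fun i _ => by positivity) (Finset.mem_univ i)

theorem norm_fst_le_epsNorm3 {ε : ℝ} (hε : 0 ≤ ε) (v : Triples Ω) (i : Fin 3) :
    ‖(v i).fst‖ ≤ epsNorm3 ε v := by
  refine (sq_le_sq₀ (by positivity) (epsNorm3_nonneg ε v)).1 ?_
  have := norm_sq_le_epsNorm3_sq hε v i
  have : 0 ≤ ε * ‖(v i).snd‖ ^ 2 := by positivity
  linarith

theorem sqrt_mul_norm_snd_le_epsNorm3 {ε : ℝ} (hε : 0 ≤ ε) (v : Triples Ω) (i : Fin 3) :
    √ε * ‖(v i).snd‖ ≤ epsNorm3 ε v := by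
  refine (sq_le_sq₀ (by positivity) (epsNorm3_nonneg ε v)).1 ?_
  rw [mul_pow, Real.sq_sqrt hε]
  have := norm_sq_le_epsNorm3_sq hε v i
  have : 0 ≤ ‖(v i).fst‖ ^ 2 := by positivity
  linarith

theorem eq_zero_of_epsNorm3_eq_zero {ε : ℝ} (hε : 0 < ε) {v : Triples Ω} (h : epsNorm3 ε v = 0) :
    v = 0 := by
  funext i
  have h1 := norm_sq_le_epsNorm3_sq hε.le v i
  rw [h] at h1
  have h2 : ‖(v i).fst‖ = 0 := by
    have : 0 ≤ ε * ‖(v i).snd‖ ^ 2 := by positivity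
    have h3 : ‖(v i).fst‖ ^ 2 = 0 := le_antisymm (by linarith) (by positivity)
    exact pow_eq_zero_iff two_ne_zero |>.1 h3
  have h3 : ‖(v i).snd‖ = 0 := by
    have : 0 ≤ ‖(v i).fst‖ ^ 2 := by positivity
    have h3 : ε * ‖(v i).snd‖ ^ 2 = 0 := le_antisymm (by linarith) (by positivity)
    simpa [hε.ne'] using h3
  exact (WithLp.equiv 2 (L2 Ω × L2Vec Ω)).injective
    (Prod.ext (norm_eq_zero.1 h2) (norm_eq_zero.1 h3))

theorem abs_inner_smul_le (p : LInf Ω) (g h : L2Vec Ω) :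
    |inner ℝ (p • g : L2Vec Ω) h| ≤ ‖p‖ * ‖g‖ * ‖h‖ :=
  (abs_real_inner_le_norm _ _).trans (by gcongr; exact Lp.norm_smul_le p g)

theorem abs_inner_smul_le' (w : L2 Ω) (G : LInfVec Ω) (h : L2Vec Ω) :
    |inner ℝ (w • G : L2Vec Ω) h| ≤ ‖w‖ * ‖G‖ * ‖h‖ :=
  (abs_real_inner_le_norm _ _).trans (by gcongr; exact Lp.norm_smul_le w G)

/-- Continuity of the linearized form in the `ε`-norm. -/
theorem abs_linForm_le {ε P Γ : ℝ} (hε : 0 < ε) (hε1 : ε ≤ 1) {p n : LInf Ω} {G : LInfVec Ω}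
    (hp : ‖p‖ ≤ P) (hn : ‖n‖ ≤ P) (hG : ‖G‖ ≤ Γ) (φ v : Triples Ω) :
    ε * |linForm ε p n G φ v| ≤ (5 + 2 * P + 2 * Γ) * (epsNorm3 ε φ * epsNorm3 ε v) := by
  set E := epsNorm3 ε φ
  set V := epsNorm3 ε v
  have hE : 0 ≤ E := epsNorm3_nonneg ε φ
  have hV : 0 ≤ V := epsNorm3_nonneg ε v
  have hP : 0 ≤ P := (norm_nonneg p).trans hp
  have hΓ : 0 ≤ Γ := (norm_nonneg G).trans hG
  have hs : √ε * √ε = ε := Real.mul_self_sqrt hε.le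
  have hs1 : √ε ≤ 1 := Real.sqrt_le_one.2 hε1
  have hs0 : 0 ≤ √ε := Real.sqrt_nonneg ε
  -- The `ε`-norm controls a gradient only after multiplication by `√ε`, so the factor `ε` on the
  -- left pays for at most two gradients.
  have grad : ∀ i j, ε * (‖(φ i).snd‖ * ‖(v j).snd‖) ≤ E * V := fun i j => by
    calc ε * (‖(φ i).snd‖ * ‖(v j).snd‖) = (√ε * ‖(φ i).snd‖) * (√ε * ‖(v j).snd‖) := by
          linear_combination (-‖(φ i).snd‖ * ‖(v j).snd‖) * hs
      _ ≤ E * V := mul_le_mul (sqrt_mul_norm_snd_le_epsNorm3 hε.le φ i)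
          (sqrt_mul_norm_snd_le_epsNorm3 hε.le v j) (by positivity) hE
  have mixed : ∀ i j, ε * (‖(φ i).fst‖ * ‖(v j).snd‖) ≤ E * V := fun i j => by
    calc ε * (‖(φ i).fst‖ * ‖(v j).snd‖) = √ε * ‖(φ i).fst‖ * (√ε * ‖(v j).snd‖) := by
          linear_combination (-‖(φ i).fst‖ * ‖(v j).snd‖) * hs
      _ ≤ (1 * E) * V := by
          gcongr
          · exact norm_fst_le_epsNorm3 hε.le φ i
          · exact sqrt_mul_norm_snd_le_epsNorm3 hε.le v j
      _ = E * V := by ring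
  have func : ∀ i j, ε * (‖(φ i).fst‖ * ‖(v j).fst‖) ≤ E * V := fun i j => by
    calc ε * (‖(φ i).fst‖ * ‖(v j).fst‖) ≤ 1 * (E * V) := by
          gcongr
          · exact norm_fst_le_epsNorm3 hε.le φ i
          · exact norm_fst_le_epsNorm3 hε.le v j
      _ = E * V := one_mul _
  have t : ∀ {a A B : ℝ}, |a| ≤ A → ε * A ≤ B → |ε * a| ≤ B := fun {a A B} h h' => by
    rw [abs_mul, abs_of_pos hε]
    exact (mul_le_mul_of_nonneg_left h hε.le).trans h'
  have coef : ∀ (i j) (q : LInf Ω), ‖q‖ ≤ P →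
      |ε * inner ℝ (q • (φ i).snd : L2Vec Ω) (v j).snd| ≤ P * (E * V) := fun i j q hq =>
    t (abs_inner_smul_le q _ _) (by
      calc ε * (‖q‖ * ‖(φ i).snd‖ * ‖(v j).snd‖) = ‖q‖ * (ε * (‖(φ i).snd‖ * ‖(v j).snd‖)) := by ring
        _ ≤ P * (E * V) := mul_le_mul hq (grad i j) (by positivity) hP)
  have drift : ∀ i j, |ε * inner ℝ ((φ i).fst • G : L2Vec Ω) (v j).snd| ≤ Γ * (E * V) :=
    fun i j => t (abs_inner_smul_le' _ G _) (by
      calc ε * (‖(φ i).fst‖ * ‖G‖ * ‖(v j).snd‖) = ‖G‖ * (ε * (‖(φ i).fst‖ * ‖(v j).snd‖)) := by ring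
        _ ≤ Γ * (E * V) := mul_le_mul hG (mixed i j) (by positivity) hΓ)
  -- Of the nine terms, five are bounded by `E * V`, two carry `P` and two carry `Γ`.
  have h1 := t (abs_real_inner_le_norm (φ 0).snd (v 0).snd) (grad 0 0)
  have h2 := coef 2 0 p hp
  have h3 := drift 0 0
  have h4 := t (abs_real_inner_le_norm (φ 1).snd (v 1).snd) (grad 1 1)
  have h5 := coef 2 1 n hn
  have h6 := drift 1 1
  have h7 : |ε * (ε * inner ℝ (φ 2).snd (v 2).snd)| ≤ E * V := by
    rw [abs_mul, abs_of_pos hε]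
    have := t (abs_real_inner_le_norm (φ 2).snd (v 2).snd) (grad 2 2)
    exact (mul_le_of_le_one_left (abs_nonneg _) hε1).trans this
  have h8 := t (abs_real_inner_le_norm (φ 0).fst (v 2).fst) (func 0 2)
  have h9 := t (abs_real_inner_le_norm (φ 1).fst (v 2).fst) (func 1 2)
  rw [← abs_of_pos hε, ← abs_mul, abs_of_pos hε, linForm]
  rw [abs_le] at *
  constructor <;> linarith

/-! ### Bounded coefficients and stability of the linearized problem. -/

theorem linfNorm_nonneg (g : Plane → ℝ) : 0 ≤ linfNorm Ω g := ENNReal.toReal_nonneg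

theorem ae_abs_le_linfNorm {g : Plane → ℝ} (hg : MemLp g ∞ (volume.restrict Ω)) :
    ∀ᵐ x ∂volume.restrict Ω, |g x| ≤ linfNorm Ω g := by
  have h := hg.2.ne
  rw [eLpNorm_exponent_top] at h
  filter_upwards [ae_le_eLpNormEssSup (f := g) (μ := volume.restrict Ω)] with x hx
  have := ENNReal.toReal_mono h hx
  rwa [toReal_enorm, Real.norm_eq_abs] at this

/-- The `L^∞` coefficients of the form linearized at a bounded triple. -/
theorem IsBoundedTriple.exists_coeff {u : Triples Ω} (hu : IsBoundedTriple u) :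
    ∃ (p n : LInf Ω) (G : LInfVec Ω), p =ᵐ[volume.restrict Ω] (u 0).fst ∧
      n =ᵐ[volume.restrict Ω] (u 1).fst ∧ G =ᵐ[volume.restrict Ω] (u 2).snd ∧
      ‖p‖ = linfNorm Ω (u 0).fst ∧ ‖n‖ = linfNorm Ω (u 1).fst ∧
      ‖G‖ ≤ √2 * max (linfNorm Ω (fun x => (u 2).snd x 0)) (linfNorm Ω (fun x => (u 2).snd x 1)) := by
  refine ⟨(hu.1 0).toLp _, (hu.1 1).toLp _, hu.2.toLp _, (hu.1 0).coeFn_toLp, (hu.1 1).coeFn_toLp,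
    hu.2.coeFn_toLp, Lp.norm_toLp _ _, Lp.norm_toLp _ _, ?_⟩
  have hc : ∀ i, MemLp (fun x => (u 2).snd x i) ∞ (volume.restrict Ω) := fun i =>
    (EuclideanSpace.proj (𝕜 := ℝ) i).comp_memLp' hu.2
  set M := max (linfNorm Ω (fun x => (u 2).snd x 0)) (linfNorm Ω (fun x => (u 2).snd x 1))
  have hM : 0 ≤ M := (linfNorm_nonneg _).trans (le_max_left _ _)
  rw [Lp.norm_toLp, eLpNorm_exponent_top]
  refine ENNReal.toReal_le_of_le_ofReal (by positivity) (eLpNormEssSup_le_of_ae_bound ?_)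
  filter_upwards [ae_abs_le_linfNorm (hc 0), ae_abs_le_linfNorm (hc 1)] with x a b
  have a' := sq_le_sq' (by linarith [abs_nonneg ((u 2).snd x 0)]) (a.trans (le_max_left _ _) : _ ≤ M)
  have b' := sq_le_sq' (by linarith [abs_nonneg ((u 2).snd x 1)]) (b.trans (le_max_right _ _) : _ ≤ M)
  rw [sq_abs] at a' b'
  -- The factor `√2` converts the maximum over two components into the Euclidean norm.
  rw [EuclideanSpace.norm_eq, Fin.sum_univ_two, Real.norm_eq_abs, Real.norm_eq_abs, sq_abs, sq_abs]
  refine Real.sqrt_le_iff.2 ⟨by positivity, ?_⟩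
  rw [mul_pow, Real.sq_sqrt (by norm_num)]
  linarith

/-- Poincaré and `ε ≤ 1` let the gradient alone dominate the `ε`-norm; this bounds the right-hand
side when testing with one component. -/
theorem epsNorm3_single_le {Cp ε : ℝ} (hC : IsPoincareConst Ω Cp) (hε : 0 < ε) (hε1 : ε ≤ 1)
    {w : Pairs Ω} (hw : w ∈ H10 Ω) (i : Fin 3) :
    epsNorm3 ε (Pi.single i w : Triples Ω) ≤ √(1 + Cp ^ 2) * ‖w.snd‖ := by
  have h := hC.2 w hw
  have h2 : ‖w.fst‖ ^ 2 ≤ (Cp * ‖w.snd‖) ^ 2 := by gcongr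
  refine (sq_le_sq₀ (epsNorm3_nonneg _ _) (by positivity)).1 ?_
  rw [epsNorm3_sq hε.le, Finset.sum_eq_single i, Pi.single_eq_same, mul_pow,
    Real.sq_sqrt (by positivity)]
  · have : ε * ‖w.snd‖ ^ 2 ≤ 1 * ‖w.snd‖ ^ 2 := by gcongr
    linarith
  · intro j _ hj
    simp [Pi.single_eq_of_ne hj]
  · simp

theorem epsNorm3_le_of_mem_H10 {Cp ε : ℝ} (hC : IsPoincareConst Ω Cp) (hε : 0 < ε) (hε1 : ε ≤ 1)
    {φ : Triples Ω} (hφ : ∀ i, φ i ∈ H10 Ω) :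
    epsNorm3 ε φ ≤ √(1 + Cp ^ 2) * (‖(φ 0).snd‖ + ‖(φ 1).snd‖ + ‖(φ 2).snd‖) := by
  have h : ∀ i, ‖(φ i).fst‖ ^ 2 + ε * ‖(φ i).snd‖ ^ 2 ≤ (1 + Cp ^ 2) * ‖(φ i).snd‖ ^ 2 := fun i => by
    have h := hC.2 _ (hφ i)
    have h2 : ‖(φ i).fst‖ ^ 2 ≤ (Cp * ‖(φ i).snd‖) ^ 2 := by gcongr
    have : ε * ‖(φ i).snd‖ ^ 2 ≤ 1 * ‖(φ i).snd‖ ^ 2 := by gcongr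
    linarith
  refine (sq_le_sq₀ (epsNorm3_nonneg _ _) (by positivity)).1 ?_
  rw [epsNorm3_sq hε.le, Fin.sum_univ_three, mul_pow, Real.sq_sqrt (by positivity)]
  have h3 : ‖(φ 0).snd‖ ^ 2 + ‖(φ 1).snd‖ ^ 2 + ‖(φ 2).snd‖ ^ 2
      ≤ (‖(φ 0).snd‖ + ‖(φ 1).snd‖ + ‖(φ 2).snd‖) ^ 2 := by
    have a := mul_nonneg (norm_nonneg (φ 0).snd) (norm_nonneg (φ 1).snd)
    have b := mul_nonneg (norm_nonneg (φ 0).snd) (norm_nonneg (φ 2).snd)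
    have c := mul_nonneg (norm_nonneg (φ 1).snd) (norm_nonneg (φ 2).snd)
    linarith
  have h4 := mul_le_mul_of_nonneg_left h3 (show 0 ≤ 1 + Cp ^ 2 by positivity)
  linarith [h 0, h 1, h 2]

theorem mul_le_of_mul_mul_le {x k B : ℝ} (hx : 0 ≤ x) (hB : 0 ≤ B) (h : x * (k * x) ≤ x * B) :
    k * x ≤ B := by
  rcases hx.eq_or_lt with rfl | hx
  · simpa using hB
  · exact le_of_mul_le_mul_left h hx

/-- Stability of the linearized problem in the `ε`-norms. -/
theorem epsNorm3_le_of_abs_linForm_le {Cp ε P Γ δ : ℝ} (hC : IsPoincareConst Ω Cp) (hε : 0 < ε)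
    (hε1 : ε ≤ 1) {p n : LInf Ω} {G : LInfVec Ω} (hp : ‖p‖ ≤ P) (hn : ‖n‖ ≤ P) (hG : ‖G‖ ≤ Γ)
    (hδ : 0 < δ) (hsmall : Γ * Cp + 2 * Cp ^ 2 * (P / ε) ≤ 1 - δ) {φ : Triples Ω}
    (hφ : ∀ i, φ i ∈ H10 Ω) {D : ℝ} (hD : 0 ≤ D)
    (hle : ∀ v : Triples Ω, (∀ i, v i ∈ H10 Ω) → |linForm ε p n G φ v| ≤ D * epsNorm3 ε v) :
    epsNorm3 ε φ ≤ √(1 + Cp ^ 2) * ((1 + Cp ^ 2) * ((1 / Cp ^ 2 + 2) * √(1 + Cp ^ 2) / δ)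
      + √(1 + Cp ^ 2)) / ε * D := by
  have hCp := hC.1
  set c := √(1 + Cp ^ 2)
  have hc : 0 ≤ c := Real.sqrt_nonneg _
  have hP : 0 ≤ P := (norm_nonneg p).trans hp
  have hΓ : 0 ≤ Γ := (norm_nonneg G).trans hG
  obtain ⟨Q, rfl⟩ : ∃ Q, P = Q * ε := ⟨P / ε, by field_simp⟩
  rw [mul_div_cancel_right₀ _ hε.ne'] at hsmall
  have hQ : 0 ≤ Q := nonneg_of_mul_nonneg_left hP hε
  have test : ∀ i, |linForm ε p n G φ (Pi.single i (φ i))| ≤ D * c * ‖(φ i).snd‖ := fun i => by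
    refine (hle _ fun j => ?_).trans ?_
    · by_cases hj : j = i
      · subst hj
        simpa using hφ j
      · rw [Pi.single_eq_of_ne hj]
        exact zero_mem _
    · rw [mul_assoc]
      exact mul_le_mul_of_nonneg_left (epsNorm3_single_le hC hε hε1 (hφ i) i) hD
  have e0 : linForm ε p n G φ (Pi.single 0 (φ 0)) = ‖(φ 0).snd‖ ^ 2
      + inner ℝ (p • (φ 2).snd : L2Vec Ω) (φ 0).snd
      + inner ℝ ((φ 0).fst • G : L2Vec Ω) (φ 0).snd := by
    simp [linForm]
  have e1 : linForm ε p n G φ (Pi.single 1 (φ 1)) = ‖(φ 1).snd‖ ^ 2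
      - inner ℝ (n • (φ 2).snd : L2Vec Ω) (φ 1).snd
      - inner ℝ ((φ 1).fst • G : L2Vec Ω) (φ 1).snd := by
    simp [linForm]
  have e2 : linForm ε p n G φ (Pi.single 2 (φ 2)) = ε * ‖(φ 2).snd‖ ^ 2
      - inner ℝ (φ 0).fst (φ 2).fst + inner ℝ (φ 1).fst (φ 2).fst := by
    simp [linForm]
  have t0 := test 0
  have t1 := test 1
  have t2 := test 2
  rw [e0] at t0
  rw [e1] at t1
  rw [e2] at t2
  have f0 := hC.2 _ (hφ 0)
  have f1 := hC.2 _ (hφ 1)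
  have f2 := hC.2 _ (hφ 2)
  have hall := epsNorm3_le_of_mem_H10 hC hε hε1 hφ
  have p0 := (abs_inner_smul_le p (φ 2).snd (φ 0).snd).trans
    (show _ ≤ Q * ε * ‖(φ 2).snd‖ * ‖(φ 0).snd‖ by gcongr)
  have p1 := (abs_inner_smul_le n (φ 2).snd (φ 1).snd).trans
    (show _ ≤ Q * ε * ‖(φ 2).snd‖ * ‖(φ 1).snd‖ by gcongr)
  have g0 := (abs_inner_smul_le' (φ 0).fst G (φ 0).snd).trans
    (show _ ≤ (Cp * ‖(φ 0).snd‖) * Γ * ‖(φ 0).snd‖ by gcongr)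
  have g1 := (abs_inner_smul_le' (φ 1).fst G (φ 1).snd).trans
    (show _ ≤ (Cp * ‖(φ 1).snd‖) * Γ * ‖(φ 1).snd‖ by gcongr)
  have w0 := (abs_real_inner_le_norm (φ 0).fst (φ 2).fst).trans
    (show _ ≤ (Cp * ‖(φ 0).snd‖) * (Cp * ‖(φ 2).snd‖) by gcongr)
  have w1 := (abs_real_inner_le_norm (φ 1).fst (φ 2).fst).trans
    (show _ ≤ (Cp * ‖(φ 1).snd‖) * (Cp * ‖(φ 2).snd‖) by gcongr)
  clear e0 e1 e2 test hle f0 f1 f2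
  have hx := norm_nonneg (φ 0).snd
  have hy := norm_nonneg (φ 1).snd
  have hz := norm_nonneg (φ 2).snd
  set x := ‖(φ 0).snd‖
  set y := ‖(φ 1).snd‖
  set z := ‖(φ 2).snd‖
  -- Each test inequality is divided by the gradient norm of its own component.
  have k0 : (1 - Γ * Cp) * x ≤ D * c + Q * ε * z := by
    refine mul_le_of_mul_mul_le hx (by positivity) ?_
    rw [abs_le] at *
    linarith
  have k1 : (1 - Γ * Cp) * y ≤ D * c + Q * ε * z := by
    refine mul_le_of_mul_mul_le hy (by positivity) ?_
    rw [abs_le] at *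
    linarith
  have k2 : ε * z ≤ D * c + Cp ^ 2 * (x + y) := by
    refine mul_le_of_mul_mul_le hz (by positivity) ?_
    rw [abs_le] at *
    linarith
  have hQ1 : Q ≤ 1 / (2 * Cp ^ 2) := by
    rw [le_div_iff₀ (by positivity)]
    have : 0 ≤ Γ * Cp := by positivity
    linarith
  -- Adding `k0` and `k1` and replacing `ε * z` by `k2` leaves the coefficient `1 - Γ * Cp - 2 * Cp
  -- ^ 2 * Q ≥ δ` on `x + y`, against `(2 + 2 * Q) * c * D`.
  have k3 : x + y ≤ (1 / Cp ^ 2 + 2) * c / δ * D := by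
    have h1 := mul_le_mul_of_nonneg_left k2 hQ
    have h2 := mul_le_mul_of_nonneg_right hsmall (add_nonneg hx hy)
    have h3 := mul_le_mul_of_nonneg_right hQ1 (mul_nonneg hD hc)
    have h4 : 1 / (2 * Cp ^ 2) = (1 / Cp ^ 2) / 2 := by field_simp
    rw [h4] at h3
    rw [div_mul_eq_mul_div, le_div_iff₀ hδ]
    linarith
  set K := (1 / Cp ^ 2 + 2) * c / δ
  rw [div_mul_eq_mul_div, le_div_iff₀ hε]
  have h5 : ε * (x + y) ≤ 1 * (x + y) := by gcongr
  -- Only `ε * z` is controlled, by `k2`; this is where `1 / ε` enters the stability constant.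
  have h6 : ε * (x + y + z) ≤ ((1 + Cp ^ 2) * K + c) * D := by
    have := mul_le_mul_of_nonneg_left k3 (show 0 ≤ 1 + Cp ^ 2 by positivity)
    linarith
  calc epsNorm3 ε φ * ε ≤ c * (x + y + z) * ε := by gcongr
    _ = c * (ε * (x + y + z)) := by ring
    _ ≤ c * (((1 + Cp ^ 2) * K + c) * D) := by gcongr
    _ = _ := by ring

/-! ### The Hilbert space `(H¹₀(Ω))³` and coercivity of the weighted form. -/

instance : CompleteSpace (H10 Ω) :=
  (Submodule.isClosed_topologicalClosure _).completeSpace_coe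

instance : InnerProductSpace ℝ (H10 Ω) := Submodule.innerProductSpace _

/-- The Hilbert space `(H¹₀(Ω))³`. -/
abbrev H10Triples (Ω : Set Plane) : Type := PiLp 2 (fun _ : Fin 3 => H10 Ω)

instance : InnerProductSpace ℝ (H10Triples Ω) := PiLp.innerProductSpace _

instance : CompleteSpace (H10Triples Ω) := PiLp.completeSpace _ _

/-- The triple underlying an element of the Hilbert space `(H¹₀(Ω))³`. -/
def H10Triples.val (h : H10Triples Ω) : Triples Ω := fun i => (h i : Pairs Ω)

theorem H10Triples.val_mem (h : H10Triples Ω) (i : Fin 3) : h.val i ∈ H10 Ω := (h i).2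

theorem norm_sq_pairs (v : Pairs Ω) : ‖v‖ ^ 2 = ‖v.fst‖ ^ 2 + ‖v.snd‖ ^ 2 :=
  WithLp.prod_norm_sq_eq_of_L2 v

theorem H10Triples.norm_sq (h : H10Triples Ω) :
    ‖h‖ ^ 2 = ∑ i, (‖(h.val i).fst‖ ^ 2 + ‖(h.val i).snd‖ ^ 2) := by
  rw [PiLp.norm_sq_eq_of_L2]
  exact Finset.sum_congr rfl fun i _ => norm_sq_pairs _

theorem H10Triples.epsNorm3_le_norm {ε : ℝ} (hε : 0 < ε) (hε1 : ε ≤ 1) (h : H10Triples Ω) :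
    epsNorm3 ε h.val ≤ ‖h‖ := by
  refine (sq_le_sq₀ (epsNorm3_nonneg _ _) (norm_nonneg _)).1 ?_
  rw [epsNorm3_sq hε.le, h.norm_sq]
  gcongr with i _
  exact mul_le_of_le_one_left (by positivity) hε1

theorem H10Triples.continuous_val_apply (i : Fin 3) :
    Continuous fun h : H10Triples Ω => h.val i :=
  continuous_subtype_val.comp (PiLp.continuous_apply 2 (fun _ : Fin 3 => H10 Ω) i)

theorem H10Triples.continuous_epsNorm3_sub (ε : ℝ) (e : Triples Ω) :
    Continuous fun h : H10Triples Ω => epsNorm3 ε (e - h.val) := by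
  have h0 : ∀ i, Continuous fun h : H10Triples Ω => (e - h.val) i := fun i =>
    continuous_const.sub (H10Triples.continuous_val_apply i)
  have h1 : ∀ i, Continuous fun h : H10Triples Ω => ((e - h.val) i).fst := fun i =>
    continuous_fst_pairs.comp (h0 i)
  have h2 : ∀ i, Continuous fun h : H10Triples Ω => ((e - h.val) i).snd := fun i =>
    continuous_snd_pairs.comp (h0 i)
  exact Real.continuous_sqrt.comp (continuous_finsetSum _ fun i _ => (Real.continuous_sqrt.comp
    (((h1 i).norm.pow 2).add (continuous_const.mul ((h2 i).norm.pow 2)))).pow 2)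

theorem epsNorm3_neg (ε : ℝ) (v : Triples Ω) : epsNorm3 ε (-v) = epsNorm3 ε v := by
  have hs : ∀ i, ((-v) i).snd = -(v i).snd := fun i => rfl
  have hf : ∀ i, ((-v) i).fst = -(v i).fst := fun i => rfl
  simp only [epsNorm3, epsNorm, hs, hf, norm_neg]

theorem H10Triples.continuous_epsNorm3 (ε : ℝ) :
    Continuous fun h : H10Triples Ω => epsNorm3 ε h.val := by
  simpa only [zero_sub, epsNorm3_neg] using continuous_epsNorm3_sub (Ω := Ω) ε 0

/-- Componentwise scaling of the test triple. -/
def weighted (w : Fin 3 → ℝ) (v : Triples Ω) : Triples Ω := fun i => w i • v i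

theorem epsNorm3_weighted_le {ε W : ℝ} (hε : 0 < ε) (hW : 0 ≤ W) {w : Fin 3 → ℝ}
    (hw : ∀ i, |w i| ≤ W) (v : Triples Ω) : epsNorm3 ε (weighted w v) ≤ W * epsNorm3 ε v := by
  refine (sq_le_sq₀ (epsNorm3_nonneg _ _) (mul_nonneg hW (epsNorm3_nonneg _ _))).1 ?_
  rw [mul_pow, epsNorm3_sq hε.le, epsNorm3_sq hε.le, Finset.mul_sum]
  refine Finset.sum_le_sum fun i _ => ?_
  have hs : (weighted w v i).snd = w i • (v i).snd := rfl
  have hf : (weighted w v i).fst = w i • (v i).fst := rfl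
  have h2 : |w i| ^ 2 ≤ W ^ 2 := by gcongr; exact hw i
  rw [hs, hf, norm_smul, norm_smul, Real.norm_eq_abs]
  calc _ = |w i| ^ 2 * (‖(v i).fst‖ ^ 2 + ε * ‖(v i).snd‖ ^ 2) := by ring
    _ ≤ _ := by gcongr

/-- The linearized form with weighted test functions, as a bounded form on `(H¹₀(Ω))³`. -/
theorem exists_weightedForm {ε : ℝ} (hε : 0 < ε) (hε1 : ε ≤ 1) (p n : LInf Ω) (G : LInfVec Ω)
    (w : Fin 3 → ℝ) : ∃ B : H10Triples Ω →L[ℝ] H10Triples Ω →L[ℝ] ℝ,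
      ∀ φ v, B φ v = linForm ε p n G φ.val (weighted w v.val) := by
  set W := ∑ i, |w i|
  have hw : ∀ i, |w i| ≤ W := fun i =>
    Finset.single_le_sum (f := fun i => |w i|) (fun i _ => abs_nonneg _) (Finset.mem_univ i)
  have hW : 0 ≤ W := (abs_nonneg _).trans (hw 0)
  have wadd : ∀ v v' : H10Triples Ω,
      weighted w (v + v').val = weighted w v.val + weighted w v'.val := fun v v' =>
    funext fun i => smul_add (w i) (v.val i) (v'.val i)
  have wsmul : ∀ (c : ℝ) (v : H10Triples Ω),
      weighted w (c • v).val = c • weighted w v.val := fun c v =>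
    funext fun i => smul_comm (w i) c (v.val i)
  let b : H10Triples Ω →ₗ[ℝ] H10Triples Ω →ₗ[ℝ] ℝ :=
    LinearMap.mk₂ ℝ (fun φ v => linForm ε p n G φ.val (weighted w v.val))
      (fun φ χ v => linForm_add_left ε p n G φ.val χ.val _)
      (fun c φ v => linForm_smul_left ε p n G c φ.val _)
      (fun φ v v' => by rw [wadd, linForm_add_right])
      (fun c φ v => by rw [wsmul, linForm_smul_right, smul_eq_mul])
  set P := max ‖p‖ ‖n‖
  have hP : 0 ≤ P := (norm_nonneg p).trans (le_max_left _ _)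
  refine ⟨b.mkContinuous₂ ((5 + 2 * P + 2 * ‖G‖) / ε * W) fun φ v => ?_, fun φ v => rfl⟩
  have h := abs_linForm_le (P := P) hε hε1 (le_max_left ‖p‖ ‖n‖) (le_max_right ‖p‖ ‖n‖) (le_refl ‖G‖) φ.val
    (weighted w v.val)
  have h1 := φ.epsNorm3_le_norm hε hε1
  have h2 := (epsNorm3_weighted_le hε hW hw v.val).trans
    (mul_le_mul_of_nonneg_left (v.epsNorm3_le_norm hε hε1) hW)
  have h3 := mul_le_mul h1 h2 (epsNorm3_nonneg _ _) (norm_nonneg φ)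
  change ‖linForm ε p n G φ.val (weighted w v.val)‖ ≤ _
  rw [Real.norm_eq_abs]
  refine le_of_mul_le_mul_left (h.trans ((mul_le_mul_of_nonneg_left h3 (by positivity)).trans_eq ?_)) hε
  field_simp

/-- Determinant over trace is a positive lower bound for the smaller eigenvalue. With this `κ`, `(α
- κ)(q - κ) = b² + κ²`, so completing the square leaves a nonnegative remainder. -/
theorem exists_pos_forall_le_quadratic {α b q : ℝ} (hα : 0 < α) (hq : 0 < q) (h : b ^ 2 < α * q) :
    ∃ κ : ℝ, 0 < κ ∧ ∀ x z : ℝ, κ * (x ^ 2 + z ^ 2) ≤ α * x ^ 2 - 2 * b * (z * x) + q * z ^ 2 := by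
  have hs : 0 < α + q := by positivity
  set κ := (α * q - b ^ 2) / (α + q)
  have hκ : κ * (α + q) = α * q - b ^ 2 := div_mul_cancel₀ _ hs.ne'
  have hκ0 : 0 < κ := div_pos (by linarith) hs
  have h1 : 0 < α - κ := by
    refine pos_of_mul_pos_left (b := α + q) ?_ hs.le
    nlinarith [sq_nonneg b]
  refine ⟨κ, hκ0, fun x z => ?_⟩
  have h2 : 0 ≤ (α - κ) * ((α - κ) * x ^ 2 - 2 * b * (z * x) + (q - κ) * z ^ 2) := by
    have : (α - κ) * ((α - κ) * x ^ 2 - 2 * b * (z * x) + (q - κ) * z ^ 2)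
        = ((α - κ) * x - b * z) ^ 2 + (κ * z) ^ 2 := by
      linear_combination (-z ^ 2) * hκ
    rw [this]
    positivity
  have := nonneg_of_mul_nonneg_right h2 h1
  linarith

/-- With a suitable weight on the third test function the linearized form is coercive. -/
theorem exists_isCoercive {Cp ε P Γ : ℝ} (hC : IsPoincareConst Ω Cp) (hε : 0 < ε)
    (hε1 : ε ≤ 1) {p n : LInf Ω} {G : LInfVec Ω} (hp : ‖p‖ ≤ P) (hn : ‖n‖ ≤ P) (hG : ‖G‖ ≤ Γ)
    (hsmall : Γ * Cp + 2 * Cp ^ 2 * (P / ε) < 1) :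
    ∃ (w : Fin 3 → ℝ) (B : H10Triples Ω →L[ℝ] H10Triples Ω →L[ℝ] ℝ), (∀ i, w i ≠ 0) ∧
      IsCoercive B ∧ ∀ φ v, B φ v = linForm ε p n G φ.val (weighted w v.val) := by
  have hCp := hC.1
  have hP : 0 ≤ P := (norm_nonneg p).trans hp
  set α := 1 - Γ * Cp
  have hPα : P < α * ε / (2 * Cp ^ 2) := by
    rw [lt_div_iff₀ (by positivity)]
    have h := mul_lt_mul_of_pos_right hsmall hε
    have h' : P / ε * ε = P := div_mul_cancel₀ _ hε.ne'
    have h'' : 2 * Cp ^ 2 * (P / ε) * ε = 2 * Cp ^ 2 * P := by rw [mul_assoc, h']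
    simp only [α]
    linarith
  -- A number strictly above `P` is used because `P` may be zero, while the weight must not be.
  obtain ⟨b, hPb, hbα⟩ := exists_between hPα
  have hb : 0 < b := hP.trans_lt hPb
  have hbα' : b * (2 * Cp ^ 2) < α * ε := (lt_div_iff₀ (by positivity)).1 hbα
  have hα : 0 < α := pos_of_mul_pos_left ((by positivity : 0 < b * (2 * Cp ^ 2)).trans hbα') hε.le
  -- This weight bounds the coupling through `φ₁v₃`, `φ₂v₃` by `l * Cp ^ 2 = b`, like the coupling
  -- through `p`, `n`. Splitting `l * ε * z²` equally between the first two components leaves two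
  -- copies of one quadratic form, positive definite exactly when `b < α * ε / (2 * Cp ^ 2)`.
  set l := b / Cp ^ 2
  have hl : 0 < l := by positivity
  have hlC : l * Cp ^ 2 = b := div_mul_cancel₀ _ (by positivity)
  obtain ⟨κ, hκ, hquad⟩ := exists_pos_forall_le_quadratic (α := α) (b := b) (q := l * ε / 2) hα
    (by positivity) (by
      have := mul_lt_mul_of_pos_left hbα' (show 0 < l / 2 by positivity)
      have h2 : l / 2 * (b * (2 * Cp ^ 2)) = b ^ 2 := by rw [← hlC]; ring
      linarith)
  obtain ⟨B, hB⟩ := exists_weightedForm hε hε1 p n G ![1, 1, l]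
  refine ⟨![1, 1, l], B, ?_, ⟨κ / (1 + Cp ^ 2), by positivity, fun h => ?_⟩, hB⟩
  · intro i
    fin_cases i <;> simp [hl.ne']
  rw [hB, mul_assoc, ← sq, h.norm_sq, Fin.sum_univ_three]
  set φ := h.val
  have hφ : ∀ i, φ i ∈ H10 Ω := h.val_mem
  have hs : ∀ i, (weighted ![1, 1, l] φ i).snd = (![1, 1, l] : Fin 3 → ℝ) i • (φ i).snd :=
    fun i => rfl
  have hf : ∀ i, (weighted ![1, 1, l] φ i).fst = (![1, 1, l] : Fin 3 → ℝ) i • (φ i).fst :=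
    fun i => rfl
  have e : linForm ε p n G φ (weighted ![1, 1, l] φ) = ‖(φ 0).snd‖ ^ 2
      + inner ℝ (p • (φ 2).snd : L2Vec Ω) (φ 0).snd
      + inner ℝ ((φ 0).fst • G : L2Vec Ω) (φ 0).snd + ‖(φ 1).snd‖ ^ 2
      - inner ℝ (n • (φ 2).snd : L2Vec Ω) (φ 1).snd
      - inner ℝ ((φ 1).fst • G : L2Vec Ω) (φ 1).snd
      + ε * (l * ‖(φ 2).snd‖ ^ 2)
      - l * inner ℝ (φ 0).fst (φ 2).fst + l * inner ℝ (φ 1).fst (φ 2).fst := by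
    simp [linForm, hs, hf, real_inner_smul_right]
  rw [e]
  have f0 := hC.2 _ (hφ 0)
  have f1 := hC.2 _ (hφ 1)
  have f2 := hC.2 _ (hφ 2)
  have hΓ : 0 ≤ Γ := (norm_nonneg G).trans hG
  have p0 := (abs_inner_smul_le p (φ 2).snd (φ 0).snd).trans
    (show _ ≤ b * ‖(φ 2).snd‖ * ‖(φ 0).snd‖ by gcongr; exact hp.trans hPb.le)
  have p1 := (abs_inner_smul_le n (φ 2).snd (φ 1).snd).trans
    (show _ ≤ b * ‖(φ 2).snd‖ * ‖(φ 1).snd‖ by gcongr; exact hn.trans hPb.le)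
  have g0 := (abs_inner_smul_le' (φ 0).fst G (φ 0).snd).trans
    (show _ ≤ (Cp * ‖(φ 0).snd‖) * Γ * ‖(φ 0).snd‖ by gcongr)
  have g1 := (abs_inner_smul_le' (φ 1).fst G (φ 1).snd).trans
    (show _ ≤ (Cp * ‖(φ 1).snd‖) * Γ * ‖(φ 1).snd‖ by gcongr)
  have load : ∀ i, ‖(φ i).fst‖ ≤ Cp * ‖(φ i).snd‖ →
      |l * inner ℝ (φ i).fst (φ 2).fst| ≤ b * ‖(φ 2).snd‖ * ‖(φ i).snd‖ := fun i hi => by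
    rw [abs_mul, abs_of_pos hl]
    calc _ ≤ l * ((Cp * ‖(φ i).snd‖) * (Cp * ‖(φ 2).snd‖)) := by
          gcongr
          exact (abs_real_inner_le_norm _ _).trans (by gcongr)
      _ = l * Cp ^ 2 * ‖(φ 2).snd‖ * ‖(φ i).snd‖ := by ring
      _ = _ := by rw [hlC]
  have w0 := load 0 f0
  have w1 := load 1 f1
  have q0 := hquad ‖(φ 0).snd‖ ‖(φ 2).snd‖
  have q1 := hquad ‖(φ 1).snd‖ ‖(φ 2).snd‖
  have s : ∀ i, ‖(φ i).fst‖ ^ 2 ≤ Cp ^ 2 * ‖(φ i).snd‖ ^ 2 := fun i => by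
    rw [← mul_pow]
    gcongr
    exact hC.2 _ (hφ i)
  have hz : 0 ≤ κ * ‖(φ 2).snd‖ ^ 2 := by positivity
  have upper : κ / (1 + Cp ^ 2) * (‖(φ 0).fst‖ ^ 2 + ‖(φ 0).snd‖ ^ 2
      + (‖(φ 1).fst‖ ^ 2 + ‖(φ 1).snd‖ ^ 2) + (‖(φ 2).fst‖ ^ 2 + ‖(φ 2).snd‖ ^ 2))
      ≤ κ * (‖(φ 0).snd‖ ^ 2 + ‖(φ 1).snd‖ ^ 2 + ‖(φ 2).snd‖ ^ 2) := by
    rw [div_mul_eq_mul_div, div_le_iff₀ (by positivity), mul_assoc]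
    gcongr
    linarith [s 0, s 1, s 2]
  refine upper.trans ?_
  simp only [α] at q0 q1
  rw [abs_le] at *
  linarith

/-! ### Density of the triples with `L²` linearized residual. -/

/-- The embedding `(H¹₀(Ω))³ → (L²(Ω))³`. -/
def H10Triples.toL2 (Ω : Set Plane) : H10Triples Ω →L[ℝ] PiLp 2 (fun _ : Fin 3 => L2 Ω) :=
  (PiLp.continuousLinearEquiv 2 ℝ (fun _ : Fin 3 => L2 Ω)).symm.toContinuousLinearMap.comp
    (ContinuousLinearMap.pi fun i => (WithLp.fstL 2 ℝ (L2 Ω) (L2Vec Ω)).comp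
      ((H10 Ω).subtypeL.comp <|
        PiLp.proj 2 (fun _ : Fin 3 => H10 Ω) i))

/-- The adjoint sends `L²` data to the Riesz representative of the functional it defines. The
orthogonal complement of its range is the kernel of the embedding, which is trivial since a function
determines its weak gradient. -/
theorem denseRange_adjoint_toL2 (hΩ : IsOpen Ω) :
    DenseRange (ContinuousLinearMap.adjoint (H10Triples.toL2 Ω)) := by
  have h : ((ContinuousLinearMap.adjoint (H10Triples.toL2 Ω)).range)ᗮ = ⊥ := by
    rw [ContinuousLinearMap.orthogonal_range, ContinuousLinearMap.adjoint_adjoint]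
    refine LinearMap.ker_eq_bot'.2 fun h hh => ?_
    ext1 i
    refine Subtype.ext (eq_zero_of_mem_H10_of_fst_eq_zero hΩ (h.val_mem i) ?_)
    change H10Triples.toL2 Ω h i = 0
    have : H10Triples.toL2 Ω h = 0 := hh
    rw [this]
    rfl
  have := Submodule.topologicalClosure_eq_top_iff.2 h
  exact (Submodule.dense_iff_topologicalClosure_eq_top.2 this)

/-- The triples whose linearized residual is represented by `L²` data are dense in `(H¹₀(Ω))³`. -/
theorem dense_setOf_exists_loadPairing (hΩ : IsOpen Ω) {Cp ε P Γ : ℝ} (hC : IsPoincareConst Ω Cp)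
    (hε : 0 < ε) (hε1 : ε ≤ 1) {p n : LInf Ω} {G : LInfVec Ω} (hp : ‖p‖ ≤ P) (hn : ‖n‖ ≤ P)
    (hG : ‖G‖ ≤ Γ) (hsmall : Γ * Cp + 2 * Cp ^ 2 * (P / ε) < 1) :
    Dense {φ : H10Triples Ω | ∃ R : Fin 3 → L2 Ω, ∀ v : Triples Ω, (∀ i, v i ∈ H10 Ω) →
      linForm ε p n G φ.val v = loadPairing R v} := by
  obtain ⟨w, B, hw, hBc, hB⟩ := exists_isCoercive hC hε hε1 hp hn hG hsmall
  set T := hBc.continuousLinearEquivOfBilin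
  refine (T.symm.surjective.denseRange.comp (denseRange_adjoint_toL2 hΩ)
    T.symm.continuous).mono ?_
  rintro _ ⟨y, rfl⟩
  -- Testing the unweighted form with `v` is testing `B` with `w⁻¹ v`, so the inverse weights move
  -- onto the data.
  refine ⟨fun i => (w i)⁻¹ • y i, fun v hv => ?_⟩
  set v' : H10Triples Ω := WithLp.toLp 2 fun i => (w i)⁻¹ • ⟨v i, hv i⟩
  have hv' : weighted w v'.val = v := funext fun i => by
    change w i • (w i)⁻¹ • v i = v i
    rw [smul_smul, mul_inv_cancel₀ (hw i), one_smul]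
  have h1 := hBc.continuousLinearEquivOfBilin_apply
    (T.symm (ContinuousLinearMap.adjoint (H10Triples.toL2 Ω) y)) v'
  rw [hB, hv'] at h1
  change linForm ε p n G (T.symm _).val v = _
  rw [← h1, loadPairing_eq_inner]
  change inner ℝ (T (T.symm _)) v' = _
  rw [T.apply_symm_apply, ContinuousLinearMap.adjoint_inner_left, PiLp.inner_apply]
  refine Finset.sum_congr rfl fun i _ => ?_
  change inner ℝ (y i) ((w i)⁻¹ • (v i).fst) = _
  rw [real_inner_smul_left, real_inner_smul_right]

/-! ### The dual norm in `[0, ∞]` and uniform regularity constants. -/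

theorem dualNorm_le {ε D : ℝ} {l : Triples Ω → ℝ} (hD : 0 ≤ D)
    (h : ∀ v : Triples Ω, (∀ i, v i ∈ H10 Ω) → |l v| ≤ D * epsNorm3 ε v) :
    dualNorm ε l ≤ ENNReal.ofReal D :=
  iSup₂_le fun v hv => ENNReal.ofReal_le_ofReal
    (div_le_of_le_mul₀ (epsNorm3_nonneg ε v) hD (h v hv))

/-- Linearity of `l` is not assumed, so its value at `0`, where the quotient is no constraint, has
to be prescribed. -/
theorem abs_le_dualNorm_mul {ε : ℝ} (hε : 0 < ε) {l : Triples Ω → ℝ} (h0 : l 0 = 0)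
    (hl : dualNorm ε l ≠ ⊤) {v : Triples Ω} (hv : ∀ i, v i ∈ H10 Ω) :
    |l v| ≤ (dualNorm ε l).toReal * epsNorm3 ε v := by
  rcases (epsNorm3_nonneg ε v).eq_or_lt with h | h
  · rw [eq_zero_of_epsNorm3_eq_zero hε h.symm, h0, abs_zero]
    exact mul_nonneg ENNReal.toReal_nonneg (epsNorm3_nonneg _ _)
  · rw [← div_le_iff₀ h]
    refine (ENNReal.ofReal_le_iff_le_toReal hl).1 ?_
    exact le_iSup₂ (f := fun (v : Triples Ω) (_ : v ∈ {v : Triples Ω | ∀ i, v i ∈ H10 Ω}) =>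
      ENNReal.ofReal (|l v| / epsNorm3 ε v)) v hv

/-- An infinite dual norm makes the claim trivial because `C > 0`; a finite one is itself an
admissible `D`. Upper estimates thus reduce to real inequalities. -/
theorem ofReal_le_ofReal_mul_dualNorm {ε a C : ℝ} (hε : 0 < ε) (hC : 0 < C) {l : Triples Ω → ℝ}
    (h0 : l 0 = 0) (h : ∀ D : ℝ, 0 ≤ D →
      (∀ v : Triples Ω, (∀ i, v i ∈ H10 Ω) → |l v| ≤ D * epsNorm3 ε v) → a ≤ C * D) :
    ENNReal.ofReal a ≤ ENNReal.ofReal C * dualNorm ε l := by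
  by_cases hl : dualNorm ε l = ⊤
  · rw [hl, ENNReal.mul_top (by simpa using hC)]
    exact le_top
  · rw [← ENNReal.ofReal_toReal hl, ← ENNReal.ofReal_mul hC.le]
    exact ENNReal.ofReal_le_ofReal
      (h _ ENNReal.toReal_nonneg fun v hv => abs_le_dualNorm_mul hε h0 hl hv)

theorem ofReal_mul_dualNorm_le {ε a C D : ℝ} (hC : 0 ≤ C) (hD : 0 ≤ D) {l : Triples Ω → ℝ}
    (h : ∀ v : Triples Ω, (∀ i, v i ∈ H10 Ω) → |l v| ≤ D * epsNorm3 ε v) (ha : C * D ≤ a) :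
    ENNReal.ofReal C * dualNorm ε l ≤ ENNReal.ofReal a :=
  calc _ ≤ ENNReal.ofReal C * ENNReal.ofReal D := by gcongr; exact dualNorm_le hD h
    _ = ENNReal.ofReal (C * D) := (ENNReal.ofReal_mul hC).symm
    _ ≤ _ := ENNReal.ofReal_le_ofReal ha

theorem loadPairing_zero (R : Fin 3 → L2 Ω) : loadPairing R 0 = 0 := by
  simp [loadPairing_eq_inner]

theorem linForm_zero_right (ε : ℝ) (p n : LInf Ω) (G : LInfVec Ω) (φ : Triples Ω) :
    linForm ε p n G φ 0 = 0 := by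
  simp [linForm]

theorem sqrt_two_mul_mul_lt_one {Cp θ : ℝ} (hCp : 0 < Cp) (hθ : θ < √2 / (1 + Cp ^ 2)) :
    √2 * Cp * θ < 1 := by
  have h2 : √2 * √2 = 2 := Real.mul_self_sqrt (by norm_num)
  have h3 : 0 < √2 := by positivity
  rw [lt_div_iff₀ (by positivity)] at hθ
  have h4 := mul_lt_mul_of_pos_left hθ (mul_pos h3 hCp)
  have h5 : √2 * Cp * √2 = 2 * Cp := by linear_combination Cp * h2
  rw [h5] at h4
  have h6 : 0 < 1 + Cp ^ 2 := by positivity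
  refine lt_of_mul_lt_mul_right ?_ h6.le
  linarith [sq_nonneg (Cp - 1)]

/-- `L^∞` coefficients of the linearization, with the bounds implied by the smallness of `u`. -/
theorem exists_coeff_of_smallnessQuantity_le {Cp ε θ : ℝ} (hCp : 0 < Cp) {u : Triples Ω}
    (hu : IsBoundedTriple u) (hS : smallnessQuantity Cp ε u ≤ θ) :
    ∃ (p n : LInf Ω) (G : LInfVec Ω) (P Γ : ℝ), p =ᵐ[volume.restrict Ω] (u 0).fst ∧
      n =ᵐ[volume.restrict Ω] (u 1).fst ∧ G =ᵐ[volume.restrict Ω] (u 2).snd ∧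
      ‖p‖ ≤ P ∧ ‖n‖ ≤ P ∧ ‖G‖ ≤ Γ ∧ Γ * Cp + 2 * Cp ^ 2 * (P / ε) ≤ √2 * Cp * θ := by
  obtain ⟨p, n, G, hp, hn, hG, np, nn, nG⟩ := hu.exists_coeff
  refine ⟨p, n, G, _, _, hp, hn, hG, np.trans_le (le_max_left _ _), nn.trans_le (le_max_right _ _),
    nG, ?_⟩
  have h := mul_le_mul_of_nonneg_left hS (show 0 ≤ √2 * Cp by positivity)
  refine le_trans (le_of_eq ?_) h
  have h2 : √2 * √2 = 2 := Real.mul_self_sqrt (by norm_num)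
  rw [smallnessQuantity, div_eq_mul_inv]
  linear_combination (-(Cp ^ 2 * ε⁻¹ * max (linfNorm Ω (u 0).fst) (linfNorm Ω (u 1).fst))) * h2

/-- Regularity constants which are uniform in `ε` and `u`. -/
theorem areRegularityConsts {Cp θ ε : ℝ} (hC : IsPoincareConst Ω Cp)
    (hθ : θ < √2 / (1 + Cp ^ 2)) (hε : 0 < ε) (hε1 : ε ≤ 1) {u : Triples Ω}
    (hu : IsBoundedTriple u) (hS : smallnessQuantity Cp ε u ≤ θ) :
    AreRegularityConsts ε u (1 / (5 + 1 / Cp ^ 2 + 2 / Cp)) (√(1 + Cp ^ 2) * ((1 + Cp ^ 2) *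
      ((1 / Cp ^ 2 + 2) * √(1 + Cp ^ 2) / (1 - √2 * Cp * θ)) + √(1 + Cp ^ 2)) / ε) := by
  have hCp := hC.1
  have hδ := sub_pos.2 (sqrt_two_mul_mul_lt_one hCp hθ)
  obtain ⟨p, n, G, P, Γ, hp, hn, hG, np, nn, nG, hsmall⟩ :=
    exists_coeff_of_smallnessQuantity_le hCp hu hS
  have hP : 0 ≤ P := (norm_nonneg p).trans np
  have hΓ : 0 ≤ Γ := (norm_nonneg G).trans nG
  set c := 5 + 1 / Cp ^ 2 + 2 / Cp
  have hc : 0 < c := by positivity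
  have hK : 0 < √(1 + Cp ^ 2) * ((1 + Cp ^ 2) *
      ((1 / Cp ^ 2 + 2) * √(1 + Cp ^ 2) / (1 - √2 * Cp * θ)) + √(1 + Cp ^ 2)) / ε := by
    positivity
  have hbound : 5 + 2 * P + 2 * Γ ≤ c := by
    have h1 : 0 ≤ Γ * Cp := by positivity
    have h2 : 0 ≤ 2 * Cp ^ 2 * (P / ε) := by positivity
    have h3 : Γ ≤ 1 / Cp := by
      rw [le_div_iff₀ hCp]
      linarith
    have h4 : P ≤ P / ε := le_div_self hP hε hε1
    have h5 : 2 * (P / ε) ≤ 1 / Cp ^ 2 := by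
      rw [le_div_iff₀ (by positivity)]
      linarith
    have h6 : 2 / Cp = 2 * (1 / Cp) := by ring
    simp only [c, h6]
    linarith
  refine ⟨by positivity, hK, fun R φ hφ hR => ⟨?_, ?_⟩⟩
  · have hE := epsNorm3_nonneg ε φ
    refine ofReal_mul_dualNorm_le (D := c / ε * epsNorm3 ε φ) (by positivity) (by positivity)
      (fun v hv => ?_) (le_of_eq (by field_simp))
    rw [← hR v hv, residualDeriv_eq_linForm ε hp hn hG]
    refine le_of_mul_le_mul_left ((abs_linForm_le hε hε1 np nn nG φ v).trans ?_) hε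
    have hV := epsNorm3_nonneg ε v
    calc _ ≤ c * (epsNorm3 ε φ * epsNorm3 ε v) := by gcongr
      _ = _ := by field_simp
  · refine ofReal_le_ofReal_mul_dualNorm hε hK (loadPairing_zero R) fun D hD hle => ?_
    refine epsNorm3_le_of_abs_linForm_le hC hε hε1 np nn nG hδ (by linarith) hφ hD fun v hv => ?_
    rw [← residualDeriv_eq_linForm ε hp hn hG, hR v hv]
    exact hle v hv

/-! ### Extension of the regularity bounds by density. -/

/-- Regularity constants control the linearization on all of `(H¹₀(Ω))³`, not only at the triples
whose linearized residual is represented by `L²` data. -/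
theorem AreRegularityConsts.abs_linForm_le_and_epsNorm3_le (hΩ : IsOpen Ω) {Cp ε P Γ C₁ C₂ : ℝ}
    (hC : IsPoincareConst Ω Cp) (hε : 0 < ε) (hε1 : ε ≤ 1) {u : Triples Ω} {p n : LInf Ω}
    {G : LInfVec Ω} (hp : p =ᵐ[volume.restrict Ω] (u 0).fst)
    (hn : n =ᵐ[volume.restrict Ω] (u 1).fst) (hG : G =ᵐ[volume.restrict Ω] (u 2).snd)
    (np : ‖p‖ ≤ P) (nn : ‖n‖ ≤ P) (nG : ‖G‖ ≤ Γ) (hsmall : Γ * Cp + 2 * Cp ^ 2 * (P / ε) < 1)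
    (hreg : AreRegularityConsts ε u C₁ C₂) {e : Triples Ω} (he : ∀ i, e i ∈ H10 Ω) :
    (∀ v : Triples Ω, (∀ i, v i ∈ H10 Ω) →
      ε * C₁ * |linForm ε p n G e v| ≤ epsNorm3 ε e * epsNorm3 ε v) ∧
    ∀ d : ℝ, 0 ≤ d → (∀ v : Triples Ω, (∀ i, v i ∈ H10 Ω) →
      |linForm ε p n G e v| ≤ d * epsNorm3 ε v) → epsNorm3 ε e ≤ C₂ * d := by
  obtain ⟨hC₁, hC₂, hreg⟩ := hreg
  have hP : 0 ≤ P := (norm_nonneg p).trans np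
  have hΓ : 0 ≤ Γ := (norm_nonneg G).trans nG
  have hdense := dense_setOf_exists_loadPairing hΩ hC hε hε1 np nn nG hsmall
  have hR : ∀ {φ : H10Triples Ω} {R : Fin 3 → L2 Ω}, (∀ v : Triples Ω, (∀ i, v i ∈ H10 Ω) →
      linForm ε p n G φ.val v = loadPairing R v) → _ := fun {φ R} h =>
    hreg R φ.val φ.val_mem fun v hv => by rw [residualDeriv_eq_linForm ε hp hn hG, h v hv]
  set e' : H10Triples Ω := WithLp.toLp 2 fun i => ⟨e i, he i⟩
  have hval : e'.val = e := rfl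
  -- Trivial weights suffice here: `B` only supplies continuity of the form in its first argument.
  obtain ⟨B, hB⟩ := exists_weightedForm hε hε1 p n G 1
  have hB' : ∀ (φ : H10Triples Ω) {v : Triples Ω} (hv : ∀ i, v i ∈ H10 Ω),
      linForm ε p n G φ.val v = B φ (WithLp.toLp 2 fun i => ⟨v i, hv i⟩) := fun φ v hv => by
    rw [hB]
    congr 1
    funext i
    exact (one_smul ℝ (v i)).symm
  constructor
  · intro v hv
    have hcl : IsClosed {φ : H10Triples Ω |
        ε * C₁ * |linForm ε p n G φ.val v| ≤ epsNorm3 ε φ.val * epsNorm3 ε v} := by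
      simp only [fun φ => hB' φ hv]
      exact isClosed_le (continuous_const.mul (B.continuous.clm_apply continuous_const).abs)
        ((H10Triples.continuous_epsNorm3 ε).mul continuous_const)
    refine (closure_minimal ?_ hcl (hdense e') :)
    rintro φ ⟨R, h⟩
    have h1 := (hR h).1
    -- The lower regularity bound itself forces finiteness, its right-hand side being finite.
    have hfin : dualNorm ε (loadPairing R) ≠ ⊤ := fun htop => by
      rw [htop, ENNReal.mul_top (by simpa using mul_pos hε hC₁)] at h1
      exact absurd h1 (by simp)
    rw [← ENNReal.ofReal_toReal hfin, ← ENNReal.ofReal_mul (by positivity),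
      ENNReal.ofReal_le_ofReal_iff (epsNorm3_nonneg _ _)] at h1
    change ε * C₁ * |linForm ε p n G φ.val v| ≤ _
    rw [h v hv]
    calc ε * C₁ * |loadPairing R v|
        ≤ ε * C₁ * ((dualNorm ε (loadPairing R)).toReal * epsNorm3 ε v) := by
          gcongr
          exact abs_le_dualNorm_mul hε (loadPairing_zero R) hfin hv
      _ = ε * C₁ * (dualNorm ε (loadPairing R)).toReal * epsNorm3 ε v := by ring
      _ ≤ _ := mul_le_mul_of_nonneg_right h1 (epsNorm3_nonneg ε v)
  · intro d hd hle
    set c := (5 + 2 * P + 2 * Γ) / ε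
    -- The bound `d` is known for `e` only, so an approximant `φ` pays for its distance to `e`. The
    -- perturbed inequality is a closed condition, and at `φ = e` the extra term vanishes.
    have hcl : IsClosed {φ : H10Triples Ω |
        epsNorm3 ε φ.val ≤ C₂ * (d + c * epsNorm3 ε (e - φ.val))} :=
      isClosed_le (H10Triples.continuous_epsNorm3 ε) (continuous_const.mul
        (continuous_const.add (continuous_const.mul (H10Triples.continuous_epsNorm3_sub ε e))))
    have hmem : epsNorm3 ε e'.val ≤ C₂ * (d + c * epsNorm3 ε (e - e'.val)) := by
      refine (closure_minimal ?_ hcl (hdense e') :)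
      rintro φ ⟨R, h⟩
      have hD : 0 ≤ d + c * epsNorm3 ε (e - φ.val) := by
        have := epsNorm3_nonneg ε (e - φ.val)
        positivity
      have h1 : dualNorm ε (loadPairing R)
          ≤ ENNReal.ofReal (d + c * epsNorm3 ε (e - φ.val)) := by
        refine dualNorm_le hD fun v hv => ?_
        have h2 : loadPairing R v
            = linForm ε p n G e v - linForm ε p n G (e - φ.val) v := by
          have := linForm_add_left ε p n G φ.val (e - φ.val) v
          rw [add_sub_cancel] at this
          rw [← h v hv]
          linarith
        have h3 := abs_linForm_le hε hε1 np nn nG (e - φ.val) v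
        have h4 : |linForm ε p n G (e - φ.val) v|
            ≤ c * epsNorm3 ε (e - φ.val) * epsNorm3 ε v := by
          refine le_of_mul_le_mul_left (h3.trans_eq ?_) hε
          simp only [c]
          field_simp
        rw [h2]
        refine (abs_sub _ _).trans ?_
        linarith [hle v hv]
      have h5 := (hR h).2.trans (mul_le_mul_right h1 _)
      rwa [← ENNReal.ofReal_mul hC₂.le, ENNReal.ofReal_le_ofReal_iff (by positivity)] at h5
    rw [hval, sub_self] at hmem
    simpa [epsNorm3, epsNorm] using hmem

/-! ### The quadratic remainder and the equivalence of error and residual. -/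

/-- The quadratic remainder of the residual. -/
theorem abs_quadratic_remainder_le {ε m : ℝ} (hε : 0 < ε) {d₀ d₁ : LInf Ω} (h₀ : ‖d₀‖ ≤ m)
    (h₁ : ‖d₁‖ ≤ m) (e v : Triples Ω) :
    ε * |inner ℝ (d₀ • (e 2).snd : L2Vec Ω) (v 0).snd
      - inner ℝ (d₁ • (e 2).snd : L2Vec Ω) (v 1).snd| ≤ √2 * m * (epsNorm3 ε e * epsNorm3 ε v) := by
  have hm : 0 ≤ m := (norm_nonneg d₀).trans h₀
  have hz := sqrt_mul_norm_snd_le_epsNorm3 hε.le e 2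
  have hV := epsNorm3_nonneg ε v
  have hE := epsNorm3_nonneg ε e
  have hs : √ε * √ε = ε := Real.mul_self_sqrt hε.le
  have h2 : √2 ^ 2 = 2 := Real.sq_sqrt (by norm_num)
  -- Adding the two gradients before comparing with the `ε`-norm costs `√2` instead of `2`, matching
  -- the `2√2` in the smallness threshold.
  have hxy : √ε * (‖(v 0).snd‖ + ‖(v 1).snd‖) ≤ √2 * epsNorm3 ε v := by
    refine (sq_le_sq₀ (by positivity) (by positivity)).1 ?_
    rw [mul_pow, mul_pow, h2, epsNorm3_sq hε.le, Fin.sum_univ_three, sq √ε, hs]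
    have a : 0 ≤ ε * ‖(v 2).snd‖ ^ 2 := by positivity
    have b : 0 ≤ ε * (‖(v 0).snd‖ - ‖(v 1).snd‖) ^ 2 := by positivity
    linarith [sq_nonneg ‖(v 0).fst‖, sq_nonneg ‖(v 1).fst‖, sq_nonneg ‖(v 2).fst‖]
  have p0 := (abs_inner_smul_le d₀ (e 2).snd (v 0).snd).trans
    (show _ ≤ m * ‖(e 2).snd‖ * ‖(v 0).snd‖ by gcongr)
  have p1 := (abs_inner_smul_le d₁ (e 2).snd (v 1).snd).trans
    (show _ ≤ m * ‖(e 2).snd‖ * ‖(v 1).snd‖ by gcongr)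
  calc _ ≤ ε * (m * ‖(e 2).snd‖ * ‖(v 0).snd‖ + m * ‖(e 2).snd‖ * ‖(v 1).snd‖) := by
        gcongr
        exact (abs_sub _ _).trans (add_le_add p0 p1)
    _ = m * ((√ε * ‖(e 2).snd‖) * (√ε * (‖(v 0).snd‖ + ‖(v 1).snd‖))) := by
        linear_combination (-m * ‖(e 2).snd‖ * (‖(v 0).snd‖ + ‖(v 1).snd‖)) * hs
    _ ≤ m * (epsNorm3 ε e * (√2 * epsNorm3 ε v)) := by gcongr
    _ = _ := by ring

/-- Equivalence of the error and the residual. -/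
theorem error_residual_equivalence (hΩ : IsOpen Ω) {Cp ε C₁ C₂ : ℝ} (hC : IsPoincareConst Ω Cp)
    (hε : 0 < ε) (hε1 : ε ≤ 1) {f : Fin 3 → L2 Ω} {u : Triples Ω} (hsol : IsWeakSolution ε f u)
    (hu : IsBoundedTriple u) (hS : smallnessQuantity Cp ε u < √2 / (1 + Cp ^ 2))
    (hreg : AreRegularityConsts ε u C₁ C₂) {e : Triples Ω} (he : ∀ i, e i ∈ H10 Ω)
    (hsmall : ∀ i : Fin 3, i ≠ 2 → MemLp (e i).fst ∞ (volume.restrict Ω) ∧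
      linfNorm Ω (e i).fst ≤ ε / (2 * √2 * C₂)) :
    ENNReal.ofReal (2 * ε * C₁ * C₂ / (C₁ + 2 * C₂)) * dualNorm ε (residual ε f (u - e))
        ≤ ENNReal.ofReal (epsNorm3 ε e) ∧
      ENNReal.ofReal (epsNorm3 ε e)
        ≤ ENNReal.ofReal (2 * C₂) * dualNorm ε (residual ε f (u - e)) := by
  have hC₁ := hreg.1
  have hC₂ := hreg.2.1
  obtain ⟨p, n, G, P, Γ, hp, hn, hG, np, nn, nG, hPΓ⟩ :=
    exists_coeff_of_smallnessQuantity_le hC.1 hu le_rfl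
  obtain ⟨hlow, hup⟩ := hreg.abs_linForm_le_and_epsNorm3_le hΩ hC hε hε1 hp hn hG np nn nG
    (hPΓ.trans_lt (sqrt_two_mul_mul_lt_one hC.1 hS)) he
  obtain ⟨m₀, n₀⟩ := hsmall 0 (by decide)
  obtain ⟨m₁, n₁⟩ := hsmall 1 (by decide)
  have hE := epsNorm3_nonneg ε e
  set Q : Triples Ω → ℝ := fun v => inner ℝ (m₀.toLp _ • (e 2).snd : L2Vec Ω) (v 0).snd
    - inner ℝ (m₁.toLp _ • (e 2).snd : L2Vec Ω) (v 1).snd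
  have hQ : ∀ v, |Q v| ≤ 1 / (2 * C₂) * epsNorm3 ε e * epsNorm3 ε v := fun v => by
    have h := abs_quadratic_remainder_le hε ((Lp.norm_toLp _ m₀).trans_le n₀)
      ((Lp.norm_toLp _ m₁).trans_le n₁) e v
    refine le_of_mul_le_mul_left (h.trans_eq ?_) hε
    field_simp
  have hres : ∀ v : Triples Ω, (∀ i, v i ∈ H10 Ω) →
      residual ε f (u - e) v = -linForm ε p n G e v + Q v := fun v hv => by
    rw [residual_sub ε f hp hn hG m₀.coeFn_toLp m₁.coeFn_toLp, hsol.2 v hv, zero_sub]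
  constructor
  · refine ofReal_mul_dualNorm_le (D := (1 / (ε * C₁) + 1 / (2 * C₂)) * epsNorm3 ε e)
      (by positivity) (by positivity) (fun v hv => ?_) ?_
    · have h1 : |linForm ε p n G e v| ≤ 1 / (ε * C₁) * epsNorm3 ε e * epsNorm3 ε v := by
        refine le_of_mul_le_mul_left ((hlow v hv).trans_eq ?_) (mul_pos hε hC₁)
        field_simp
      rw [hres v hv]
      refine (abs_add_le _ _).trans ?_
      rw [abs_neg]
      linarith [hQ v]
    · rw [← mul_assoc]
      refine mul_le_of_le_one_left hE ?_
      have h1 : 2 * ε * C₁ * C₂ / (C₁ + 2 * C₂) * (1 / (ε * C₁) + 1 / (2 * C₂))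
          = (2 * C₂ + ε * C₁) / (C₁ + 2 * C₂) := by
        field_simp
      rw [h1, div_le_one (by positivity)]
      have := mul_le_of_le_one_left hC₁.le hε1
      linarith
  · have h0 : residual ε f (u - e) 0 = 0 := by
      rw [hres 0 fun i => zero_mem _, linForm_zero_right]
      simp [Q]
    refine ofReal_le_ofReal_mul_dualNorm hε (by positivity) h0 fun D hD hle => ?_
    -- The remainder contributes `C₂ * (1 / (2 * C₂)) = 1 / 2` of the error, which is absorbed into
    -- the left side and doubles the constant.
    have h := hup (D + 1 / (2 * C₂) * epsNorm3 ε e) (by positivity) fun v hv => by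
      have h1 : linForm ε p n G e v = Q v - residual ε f (u - e) v := by
        rw [hres v hv]
        ring
      rw [h1]
      refine (abs_sub _ _).trans ?_
      linarith [hQ v, hle v hv]
    have h2 : C₂ * (D + 1 / (2 * C₂) * epsNorm3 ε e) = C₂ * D + epsNorm3 ε e / 2 := by
      field_simp
    linarith

end PNP

end

theorem theorem3p1 (Ω : Set PNP.Plane) (hΩ : IsOpen Ω) (hΩb : Bornology.IsBounded Ω) :
    (∃ Cp : ℝ, PNP.IsPoincareConst Ω Cp) ∧
    ∀ Cp : ℝ, PNP.IsPoincareConst Ω Cp →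
      -- existence of the constants and what they depend on
      (∃ C₁ : ℝ, 0 < C₁ ∧ ∀ θ : ℝ, θ < Real.sqrt 2 / (1 + Cp ^ 2) →
        ∃ K : ℝ, 0 < K ∧ ∀ (ε : ℝ) (u : PNP.Triples Ω), 0 < ε → ε ≤ 1 → (∀ i, u i ∈ PNP.H1 Ω) →
          PNP.IsBoundedTriple u → PNP.smallnessQuantity Cp ε u ≤ θ →
          PNP.AreRegularityConsts ε u C₁ (K / ε)) ∧
      -- the equivalence of error and residual
      (∀ (ε : ℝ) (f : Fin 3 → PNP.L2 Ω) (u : PNP.Triples Ω), 0 < ε → ε ≤ 1 →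
        PNP.IsWeakSolution ε f u → PNP.IsBoundedTriple u →
        PNP.smallnessQuantity Cp ε u < Real.sqrt 2 / (1 + Cp ^ 2) →
        ∀ C₁ C₂ : ℝ, PNP.AreRegularityConsts ε u C₁ C₂ →
        ∀ uh : PNP.Triples Ω, (∀ i, uh i ∈ PNP.H1 Ω) → (∀ i, u i - uh i ∈ PNP.H10 Ω) →
          (∀ i : Fin 3, i ≠ 2 →
            MemLp (u i - uh i).fst ∞ (volume.restrict Ω) ∧
            PNP.linfNorm Ω (u i - uh i).fst ≤ ε / (2 * Real.sqrt 2 * C₂)) →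
          ENNReal.ofReal (2 * ε * C₁ * C₂ / (C₁ + 2 * C₂)) * PNP.dualNorm ε (PNP.residual ε f uh)
              ≤ ENNReal.ofReal (PNP.epsNorm3 ε (u - uh)) ∧
          ENNReal.ofReal (PNP.epsNorm3 ε (u - uh))
              ≤ ENNReal.ofReal (2 * C₂) * PNP.dualNorm ε (PNP.residual ε f uh)) := by
  refine ⟨PNP.exists_isPoincareConst hΩb, fun Cp hC => ⟨?_, ?_⟩⟩
  · have hCp := hC.1
    refine ⟨1 / (5 + 1 / Cp ^ 2 + 2 / Cp), by positivity, fun θ hθ => ?_⟩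
    have hδ := sub_pos.2 (PNP.sqrt_two_mul_mul_lt_one hCp hθ)
    exact ⟨_, by positivity, fun ε u hε hε1 _ hu hS =>
      PNP.areRegularityConsts hC hθ hε hε1 hu hS⟩
  · intro ε f u hε hε1 hsol hu hS C₁ C₂ hreg uh _ he hsmall
    have h := PNP.error_residual_equivalence hΩ hC hε hε1 hsol hu hS hreg (e := u - uh) he hsmall
    rwa [sub_sub_cancel] at h
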